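/- Let $R$ be a Noetherian regular local ring of prime characteristic $p$, and let $S=R_\infty$ be its perfect closure, i.e. the ring obtained by adjoining to $R$ the $p^n$-th roots of all its elements, for all $n$. Notation for a commutative ring $A$. For a finite sequence $\underline{x}=x_1,\dots,x_r$ in $A$ let $\mathbb{K}_\bullet(\underline{x})$ be its Koszul complex and $H^i_{\underline{x}}(A)$ the $i$-th cohomology of the Čech complex of $A$ with respect to $\underline{x}$. For an ideal $\mathfrak a$ of $A$ the Koszul grade $\operatorname{K.grade}_A(\mathfrak a,A)\in\mathbb{N}\cup\{\infty\}$ is the supremum, over all finite sequences $\underline{x}$ of elements of $\mathfrak a$, of $\inf\{i\ge 0 : H^i(\operatorname{Hom}_A(\mathbb{K}_\bullet(\underline{x}),A))\ne 0\}$ (with $\inf\emptyset=\infty$). The height $\operatorname{ht}\mathfrak a$ is the infimum of the heights of the primes containing $\mathfrak a$, and $\operatorname{ht}A=\infty$. For a finitely generated ideal $\mathfrak a$, $\mu(\mathfrak a)$ is the minimal number of generators. A prime is weakly associated to an $A$-module $M$ if it is minimal over $(0:_A m)$ for some $m\in M$; the set of these primes is $\operatorname{wAss}_A M$. The sequence $\underline{x}$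 is weakly proregular if for each $n>0$ there is $m\ge n$ such that the map $H_i(\mathbb{K}_\bullet(\underline{x}^m))\to H_i(\mathbb{K}_\bullet(\underline{x}^n))$, induced by $e_j\mapsto x_j^{m-n}e_j$, is zero for all $i\ge1$. A sequence $\underline{x}=x_1,\dots,x_\ell$ is a parameter sequence if it is weakly proregular, $(\underline{x})A\ne A$, and $H^\ell_{\underline{x}}(A)_{\mathfrak p}\ne0$ for all primes $\mathfrak p\supseteq(\underline{x})$; it is a strong parameter sequence if $x_1,\dots,x_i$ is a parameter sequence for all $1\le i\le\ell$. Then $S$ is Cohen–Macaulay in each of the following senses. 1. (Hamilton–Marley) Every strong parameter sequence on $S$ is a regular sequence on $S$. 2. (Glaz) $\operatorname{ht}\mathfrak p=\operatorname{K.grade}_{S_{\mathfrak p}}(\mathfrak pS_{\mathfrak p},S_{\mathfrak p})$ for every prime ideal $\mathfrak p$ of $S$. 3. (Weak Bourbaki unmixed) For every finitely generated ideal $\mathfrak a$ of $S$ with $\operatorname{ht}\mathfrak a\ge\mu(\mathfrak a)$, the set of minimal primes of $\mathfrak a$ equals $\operatorname{wAss}_S(S/\mathfrak a)$. 4. For every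 non-empty class $\mathcal A$ of ideals of $S$, $\operatorname{ht}\mathfrak a=\operatorname{K.grade}_S(\mathfrak a,S)$ for all $\mathfrak a\in\mathcal A$; in particular this holds for the class of prime ideals, of maximal ideals, of all ideals, and of finitely generated ideals of $S$. -/

import Mathlib

noncomputable section

namespace NonNoetherianCM

universe u v

section Koszul

variable {R : Type u} [CommRing R] {r : ℕ}

/-- The differential `K_{k+1}(x) → K_k(x)` of the Koszul complex `K_•(x)`, where
`K_k(x) = ⋀^k R^r`:
`v₀ ∧ ⋯ ∧ v_k ↦ ∑ i, (-1)^i (∑ j, x_j (v_i)_j) • v₀ ∧ ⋯ ∧ v̂_i ∧ ⋯ ∧ v_k`. -/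
def koszulD (x : Fin r → R) (k : ℕ) :
    ⋀[R]^(k + 1) (Fin r → R) →ₗ[R] ⋀[R]^k (Fin r → R) :=
  exteriorPower.alternatingMapLinearEquiv
    (AlternatingMap.alternatizeUncurryFin
      ((Fintype.linearCombination R x).smulRight (exteriorPower.ιMulti R k)))

theorem koszulD_ιMulti (x : Fin r → R) (k : ℕ) (v : Fin (k + 1) → Fin r → R) :
    koszulD x k (exteriorPower.ιMulti R (k + 1) v) =
      ∑ i : Fin (k + 1), (-1 : ℤ) ^ (i : ℕ) •
        ((∑ j, v i j * x j) • exteriorPower.ιMulti R k (i.removeNth v)) := by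
  simp [koszulD, AlternatingMap.alternatizeUncurryFin_apply, Fintype.linearCombination_apply]

theorem koszulD_comp_koszulD (x : Fin r → R) (k : ℕ) :
    koszulD x k ∘ₗ koszulD x (k + 1) = 0 := by
  apply exteriorPower.linearMap_ext
  have h := AlternatingMap.alternatizeUncurryFin_alternatizeUncurryFinLM_comp_of_symmetric
    (f := (Fintype.linearCombination R x).smulRight
      ((Fintype.linearCombination R x).smulRight (exteriorPower.ιMulti R k (M := Fin r → R))))
    (by intro a b; simp [smul_smul, mul_comm])
  ext v : 1
  have h2 := congrArg (fun f => f v) h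
  simp only [LinearMap.compAlternatingMap_apply, LinearMap.comp_apply, koszulD_ιMulti, map_sum,
    map_zsmul, map_smul]
  simpa [AlternatingMap.alternatizeUncurryFin_apply, Fintype.linearCombination_apply] using h2

/-- The coboundary `Hom(K_k(x), M) → Hom(K_{k+1}(x), M)`. -/
def koszulCoboundary (x : Fin r → R) (M : Type v) [AddCommGroup M] [Module R M] (k : ℕ) :
    (⋀[R]^k (Fin r → R) →ₗ[R] M) →ₗ[R] (⋀[R]^(k + 1) (Fin r → R) →ₗ[R] M) :=
  LinearMap.lcomp R M (koszulD x k)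

/-- The submodule of `i`-coboundaries of `Hom(K_•(x), M)`. -/
def koszulBoundaries (x : Fin r → R) (M : Type v) [AddCommGroup M] [Module R M] :
    (i : ℕ) → Submodule R (⋀[R]^i (Fin r → R) →ₗ[R] M)
  | 0 => ⊥
  | k + 1 => LinearMap.range (koszulCoboundary x M k)

/-- The Koszul cohomology module `H^i(Hom(K_•(x), M))`. -/
abbrev KoszulCohomology (x : Fin r → R) (M : Type v) [AddCommGroup M] [Module R M] (i : ℕ) :
    Type (max u v) :=
  LinearMap.ker (koszulCoboundary x M i) ⧸
    (koszulBoundaries x M i).submoduleOf (LinearMap.ker (koszulCoboundary x M i))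

/-- `inf {i | H^i(Hom(K_•(x), M)) ≠ 0}`, with `inf ∅ = ∞`. -/
def koszulGradeSeq (x : Fin r → R) (M : Type v) [AddCommGroup M] [Module R M] : ℕ∞ :=
  ⨅ (i : ℕ) (_ : Nontrivial (KoszulCohomology x M i)), (i : ℕ∞)

/-- The Koszul grade `K.grade_R(a, M)`: the supremum of the Koszul grades of the finitely
generated subideals of `a`. Each of those is given by a finite generating sequence, so the
supremum runs over all finite sequences of elements of `a`. -/
def koszulGrade (a : Ideal R) (M : Type v) [AddCommGroup M] [Module R M] : ℕ∞ :=
  ⨆ (r : ℕ) (x : Fin r → R) (_ : ∀ i, x i ∈ a), koszulGradeSeq x M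

/-- The map `K_k(x^m) → K_k(x^n)` (for `m ≥ n`), induced on exterior powers by
`e_i ↦ x_i^(m-n) e_i`. -/
def koszulPowMap (x : Fin r → R) (m n k : ℕ) :
    ⋀[R]^k (Fin r → R) →ₗ[R] ⋀[R]^k (Fin r → R) :=
  exteriorPower.map k (LinearMap.pi fun i => (x i ^ (m - n)) • LinearMap.proj i)

/-- The maps `K_k(x^m) → K_k(x^n)` form a chain map. -/
theorem koszulD_comp_koszulPowMap (x : Fin r → R) {m n : ℕ} (h : n ≤ m) (k : ℕ) :
    koszulD (fun i => x i ^ n) k ∘ₗ koszulPowMap x m n (k + 1) =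
      koszulPowMap x m n k ∘ₗ koszulD (fun i => x i ^ m) k := by
  apply exteriorPower.linearMap_ext
  ext v : 1
  simp only [LinearMap.compAlternatingMap_apply, LinearMap.comp_apply, koszulPowMap,
    exteriorPower.map_apply_ιMulti, koszulD_ιMulti, map_sum, map_zsmul, map_smul]
  refine Finset.sum_congr rfl fun i _ => ?_
  congr 2
  refine Finset.sum_congr rfl fun j _ => ?_
  simp only [Function.comp, LinearMap.pi_apply, LinearMap.smul_apply, LinearMap.proj_apply,
    smul_eq_mul]
  rw [← Nat.sub_add_cancel h, pow_add]
  simp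
  ring

/-- `x` is weakly proregular: for every `n > 0` there is `m ≥ n` such that
`H_i(K_•(x^m)) → H_i(K_•(x^n))` is zero for all `i ≥ 1` (here `i = k + 1`), that is, every
`i`-cycle of `K_•(x^m)` is mapped to an `i`-boundary of `K_•(x^n)`. -/
def IsWeaklyProregular (x : Fin r → R) : Prop :=
  ∀ n : ℕ, 0 < n → ∃ m : ℕ, n ≤ m ∧ ∀ k : ℕ,
    ∀ z : ⋀[R]^(k + 1) (Fin r → R), koszulD (fun i => x i ^ m) k z = 0 →
      koszulPowMap x m n (k + 1) z ∈ LinearMap.range (koszulD (fun i => x i ^ n) (k + 1))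

end Koszul

section Cech

variable {R : Type u} [CommRing R] {r : ℕ}

/-- The ring `R_{x_I}`, the localization of `R` at `∏ i ∈ I, x i`. -/
abbrev CechTerm (x : Fin r → R) (I : Finset (Fin r)) : Type u :=
  Localization.Away (∏ i ∈ I, x i)

theorem isUnit_cechTerm (x : Fin r → R) {I J : Finset (Fin r)} (h : I ⊆ J) :
    IsUnit (Algebra.ofId R (CechTerm x J) (∏ i ∈ I, x i)) :=
  isUnit_of_dvd_unit (map_dvd _ (Finset.prod_dvd_prod_of_subset _ _ _ h))
    (IsLocalization.Away.algebraMap_isUnit (∏ i ∈ J, x i))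

/-- The canonical map `R_{x_I} → R_{x_J}` for `I ⊆ J`. -/
def cechRestrict (x : Fin r → R) {I J : Finset (Fin r)} (h : I ⊆ J) :
    CechTerm x I →ₐ[R] CechTerm x J :=
  IsLocalization.Away.liftAlgHom (∏ i ∈ I, x i) (isUnit_cechTerm x h)

/-- The `k`-th term `⨁_{|I| = k} R_{x_I}` of the Čech complex of `R` with respect to `x`. -/
abbrev CechCochain (x : Fin r → R) (k : ℕ) : Type u :=
  (I : {I : Finset (Fin r) // I.card = k}) → CechTerm x I.1

/-- The differential of the Čech complex:
`(d c)_J = ∑_{j ∈ J} (-1)^{#{i ∈ J | i < j}} c_{J \ {j}}`. -/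
def cechD (x : Fin r → R) (k : ℕ) : CechCochain x k →ₗ[R] CechCochain x (k + 1) :=
  LinearMap.pi fun J => ∑ j : J.1,
    (-1 : ℤ) ^ ({i ∈ J.1 | i < j.1} : Finset (Fin r)).card •
      ((cechRestrict x (Finset.erase_subset j.1 J.1)).toLinearMap ∘ₗ
        LinearMap.proj (φ := fun I : {I : Finset (Fin r) // I.card = k} => CechTerm x I.1)
          ⟨J.1.erase j.1, by rw [Finset.card_erase_of_mem j.2, J.2, Nat.add_sub_cancel]⟩)

/-- The submodule of `i`-coboundaries of the Čech complex. -/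
def cechBoundaries (x : Fin r → R) : (i : ℕ) → Submodule R (CechCochain x i)
  | 0 => ⊥
  | k + 1 => LinearMap.range (cechD x k)

/-- The Čech cohomology module `H^i_x(R)`. -/
abbrev CechCohomology (x : Fin r → R) (i : ℕ) : Type u :=
  LinearMap.ker (cechD x i) ⧸ (cechBoundaries x i).submoduleOf (LinearMap.ker (cechD x i))

end Cech

section CohenMacaulay

variable {R : Type u} [CommRing R]

/-- `x₁, …, x_ℓ` is a parameter sequence on `R`: it is weakly proregular, generates a proper
ideal, and `H^ℓ_x(R)_p ≠ 0` for every prime `p ⊇ (x)`. -/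
structure IsParameterSequence {l : ℕ} (x : Fin l → R) : Prop where
  weaklyProregular : IsWeaklyProregular x
  span_ne_top : Ideal.span (Set.range x) ≠ ⊤
  cech_ne_zero : ∀ (p : Ideal R) [p.IsPrime], Ideal.span (Set.range x) ≤ p →
    Nontrivial (LocalizedModule p.primeCompl (CechCohomology x l))

/-- `x₁, …, x_i` is a parameter sequence for each `1 ≤ i ≤ ℓ`. -/
def IsStrongParameterSequence {l : ℕ} (x : Fin l → R) : Prop :=
  ∀ (i : ℕ) (h : i ≤ l), 1 ≤ i → IsParameterSequence fun j : Fin i => x (Fin.castLE h j)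

/-- The weakly associated primes of `M`: the primes minimal over `(0 :_R m)` for some `m : M`. -/
def weaklyAssociatedPrimes (R : Type u) [CommRing R] (M : Type v) [AddCommGroup M] [Module R M] :
    Set (Ideal R) :=
  {p | ∃ m : M, p ∈ Ideal.minimalPrimes (LinearMap.ker (LinearMap.toSpanSingleton R M m))}

variable (R)

/-- Cohen-Macaulay in the sense of Hamilton-Marley. -/
def IsHamiltonMarleyCM : Prop :=
  ∀ (l : ℕ) (x : Fin l → R), IsStrongParameterSequence x →
    RingTheory.Sequence.IsRegular R (List.ofFn x)

/-- Cohen-Macaulay in the sense of Glaz. -/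
def IsGlazCM : Prop :=
  ∀ (p : Ideal R) [p.IsPrime],
    p.height = koszulGrade (p.map (algebraMap R (Localization.AtPrime p)))
      (Localization.AtPrime p)

/-- Weak Bourbaki unmixed. For a finitely generated ideal, `Submodule.spanFinrank` is the minimal
number of generators. -/
def IsWeakBourbakiUnmixed : Prop :=
  ∀ a : Ideal R, a.FG → (a.spanFinrank : ℕ∞) ≤ a.height →
    a.minimalPrimes = weaklyAssociatedPrimes R (R ⧸ a)

variable {R}

/-- Cohen-Macaulay in the sense of a class `𝒜` of ideals of `R`. -/
def IsCMInSenseOf (𝒜 : Set (Ideal R)) : Prop :=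
  ∀ a ∈ 𝒜, a.height = koszulGrade a R

end CohenMacaulay

end NonNoetherianCM

end

noncomputable section

namespace NonNoetherianCM

universe u v

open RingTheory.Sequence IsLocalRing Filter
open scoped Pointwise

/-! Write S for the perfect closure of R. Everything rests on `isWeaklyRegular_of_isPRadical`:
elements of S generating a proper ideal of height at least their number form a regular sequence.
Each element of S has a p^e-th power in R, Frobenius is bijective on S, and Spec S → Spec R is an
order isomorphism, so heights agree. Hence a relation in S can be raised to a large p-power until it
lives in R, solved there by the Cohen-Macaulay property of R, and brought back by taking the root in
S.

For R itself, depth is measured by vanishing of Koszul cohomology. A regular local ring has a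
regular sequence of length dim R in its maximal ideal; an associated prime of a module whose Koszul
cohomology vanishes below k has coheight at least k; dimension counting then gives unmixedness.

The four conclusions follow. A regular sequence inside an ideal bounds its Koszul grade below, and a
prime containing the ideal and minimal over a regular sequence bounds it above; every proper ideal
of S contains a regular sequence of length its height, so height and grade agree, also after
localizing. For unmixedness, an embedded weakly associated prime of S/a would contain an element
that extends the generators of a to a regular sequence. For Hamilton-Marley, too small a height
would kill a localized top Čech cohomology module (`le_height_of_isStrongParameterSequence`). -/

/-- In the localization at q, the radical of I is q. This turns minimality of primes into equations
wherever it is used. -/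
theorem exists_mul_pow_mem_of_mem_minimalPrimes {A : Type u} [CommRing A] {I q : Ideal A}
    (hq : q ∈ I.minimalPrimes) {x : A} (hx : x ∈ q) :
    ∃ (s : A) (n : ℕ), s ∉ q ∧ s * x ^ n ∈ I := by
  have := hq.1.1
  by_contra! h
  obtain ⟨P, hP, hIP, hdisj⟩ := Ideal.exists_le_prime_disjoint I (q.primeCompl ⊔ Submonoid.powers x)
    (Set.disjoint_left.2 fun a ha ha' => by
      obtain ⟨s, hs, _, ⟨n, rfl⟩, rfl⟩ := Submonoid.mem_sup.1 ha'
      exact h s n hs ha)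
  have hPq : P ≤ q := fun a ha => by
    by_contra haq
    exact Set.disjoint_left.1 hdisj ha (Submonoid.mem_sup_left (show a ∈ q.primeCompl from haq))
  exact Set.disjoint_left.1 hdisj (hq.2 ⟨hP, hIP⟩ hPq hx)
    (Submonoid.mem_sup_right (Submonoid.mem_powers x))

/-! ### Koszul cohomology, regular sequences and bounds on the Koszul grade. -/

section KoszulVanishing

variable {A : Type u} [CommRing A] {r : ℕ} (x : Fin r → A)

/-- The Koszul cohomology `H^i(x; M)` vanishes for all `i < n`. -/
def KoszulVanishesBelow (M : Type v) [AddCommGroup M] [Module A M] (n : ℕ) : Prop :=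
  ∀ i < n, ∀ φ : ⋀[A]^i (Fin r → A) →ₗ[A] M, φ ∘ₗ koszulD x i = 0 → φ ∈ koszulBoundaries x M i

variable {x} {M : Type v} [AddCommGroup M] [Module A M]

theorem mem_koszulBoundaries_succ {k : ℕ} {φ : ⋀[A]^(k + 1) (Fin r → A) →ₗ[A] M} :
    φ ∈ koszulBoundaries x M (k + 1) ↔ ∃ ψ : ⋀[A]^k (Fin r → A) →ₗ[A] M, ψ ∘ₗ koszulD x k = φ :=
  Iff.rfl

theorem mem_koszulBoundaries_zero {φ : ⋀[A]^0 (Fin r → A) →ₗ[A] M} :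
    φ ∈ koszulBoundaries x M 0 ↔ φ = 0 :=
  Iff.rfl

theorem subsingleton_koszulCohomology_iff {i : ℕ} :
    Subsingleton (KoszulCohomology x M i) ↔
      ∀ φ : ⋀[A]^i (Fin r → A) →ₗ[A] M, φ ∘ₗ koszulD x i = 0 → φ ∈ koszulBoundaries x M i := by
  rw [Submodule.Quotient.subsingleton_iff, Submodule.submoduleOf,
    Submodule.comap_subtype_eq_top]
  rfl

theorem natCast_le_koszulGradeSeq_iff {n : ℕ} :
    (n : ℕ∞) ≤ koszulGradeSeq x M ↔ KoszulVanishesBelow x M n := by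
  simp only [koszulGradeSeq, le_iInf_iff, KoszulVanishesBelow,
    ← subsingleton_koszulCohomology_iff, Nat.cast_le]
  refine forall_congr' fun i => ?_
  rw [← not_subsingleton_iff_nontrivial, ← not_imp_not, not_not, not_le]

theorem KoszulVanishesBelow.mono {m n : ℕ} (h : KoszulVanishesBelow x M n) (hmn : m ≤ n) :
    KoszulVanishesBelow x M m :=
  fun i hi => h i (hi.trans_le hmn)

theorem koszulBoundaries_comp_koszulD {i : ℕ} {φ : ⋀[A]^i (Fin r → A) →ₗ[A] M}
    (h : φ ∈ koszulBoundaries x M i) : φ ∘ₗ koszulD x i = 0 := by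
  cases i with
  | zero => rw [mem_koszulBoundaries_zero.1 h, LinearMap.zero_comp]
  | succ k =>
    obtain ⟨ψ, rfl⟩ := mem_koszulBoundaries_succ.1 h
    rw [LinearMap.comp_assoc, koszulD_comp_koszulD, LinearMap.comp_zero]

theorem koszulBoundaries_map {N : Type*} [AddCommGroup N] [Module A N] (g : M →ₗ[A] N) {i : ℕ}
    {φ : ⋀[A]^i (Fin r → A) →ₗ[A] M} (h : φ ∈ koszulBoundaries x M i) :
    g ∘ₗ φ ∈ koszulBoundaries x N i := by
  cases i with
  | zero => rw [mem_koszulBoundaries_zero.1 h]; simp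
  | succ k =>
    obtain ⟨ψ, rfl⟩ := mem_koszulBoundaries_succ.1 h
    exact ⟨g ∘ₗ ψ, rfl⟩

/-- A linear map on a projective module that vanishes modulo `y` is divisible by `y`. -/
theorem exists_eq_smul_of_mkQ_comp_eq_zero {P : Type*} [AddCommGroup P] [Module A P]
    [Module.Projective A P] (y : A) (φ : P →ₗ[A] M)
    (h : (y • (⊤ : Submodule A M)).mkQ ∘ₗ φ = 0) : ∃ ψ : P →ₗ[A] M, φ = y • ψ := by
  have hmem (a : P) : φ a ∈ LinearMap.range (LinearMap.lsmul A M y) := by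
    have := LinearMap.congr_fun h a
    simp only [LinearMap.comp_apply, LinearMap.zero_apply, Submodule.mkQ_apply,
      Submodule.Quotient.mk_eq_zero] at this
    obtain ⟨m, -, hm⟩ := this
    exact ⟨m, hm⟩
  obtain ⟨ψ, hψ⟩ := Module.projective_lifting_property (LinearMap.lsmul A M y).rangeRestrict
    (φ.codRestrict _ hmem) (LinearMap.surjective_rangeRestrict _)
  refine ⟨ψ, LinearMap.ext fun a => ?_⟩
  have := congrArg Subtype.val (LinearMap.congr_fun hψ a)
  simpa using this.symm

theorem smul_linearMap_injective {P : Type*} [AddCommGroup P] [Module A P] {y : A}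
    (hy : IsSMulRegular M y) {φ ψ : P →ₗ[A] M} (h : y • φ = y • ψ) : φ = ψ :=
  LinearMap.ext fun a => hy (LinearMap.congr_fun h a)

/-- Passing to the quotient by a regular element lowers the vanishing range by at most one. -/
theorem KoszulVanishesBelow.quotSMulTop {y : A} (hy : IsSMulRegular M y) {n : ℕ}
    (h : KoszulVanishesBelow x M (n + 1)) : KoszulVanishesBelow x (QuotSMulTop y M) n := by
  intro i hi φ hφ
  obtain ⟨φ', rfl⟩ := Module.projective_lifting_property (y • (⊤ : Submodule A M)).mkQ φ
    (Submodule.mkQ_surjective _)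
  -- The connecting homomorphism by hand: the coboundary of the lift `φ'` is `y • ψ` with `ψ` a
  -- cocycle one degree up. Writing `ψ` as the coboundary of `χ` makes `φ' - y • χ` a cocycle over
  -- `M`.
  obtain ⟨ψ, hψ⟩ := exists_eq_smul_of_mkQ_comp_eq_zero y (φ' ∘ₗ koszulD x i) hφ
  have hψ0 : ψ ∘ₗ koszulD x (i + 1) = 0 := by
    apply smul_linearMap_injective hy
    rw [smul_zero, ← LinearMap.smul_comp, ← hψ, LinearMap.comp_assoc, koszulD_comp_koszulD,
      LinearMap.comp_zero]
  obtain ⟨χ, hχ⟩ := mem_koszulBoundaries_succ.1 (h (i + 1) (by omega) ψ hψ0)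
  have hb := h i (by omega) (φ' - y • χ) (by
    rw [LinearMap.sub_comp, hψ, LinearMap.smul_comp, hχ, sub_self])
  convert koszulBoundaries_map (y • (⊤ : Submodule A M)).mkQ hb using 1
  refine LinearMap.ext fun a => ?_
  have : y • χ a ∈ y • (⊤ : Submodule A M) := Submodule.smul_mem_pointwise_smul _ _ _ trivial
  rw [LinearMap.comp_apply, LinearMap.comp_apply, LinearMap.sub_apply, map_sub,
    LinearMap.smul_apply, Submodule.mkQ_apply _ (y • χ a), (Submodule.Quotient.mk_eq_zero _).2 this,
    sub_zero]

/-- Left exterior multiplication by `v`. -/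
def wedgeLeft (v : Fin r → A) (k : ℕ) : ⋀[A]^k (Fin r → A) →ₗ[A] ⋀[A]^(k + 1) (Fin r → A) :=
  exteriorPower.alternatingMapLinearEquiv ((exteriorPower.ιMulti A (k + 1)).curryLeft v)

theorem wedgeLeft_ιMulti (v : Fin r → A) (k : ℕ) (w : Fin k → Fin r → A) :
    wedgeLeft v k (exteriorPower.ιMulti A k w) =
      exteriorPower.ιMulti A (k + 1) (Matrix.vecCons v w) := by
  simp [wedgeLeft]

theorem koszulD_comp_wedgeLeft_zero (x v : Fin r → A) :
    koszulD x 0 ∘ₗ wedgeLeft v 0 = (∑ j, v j * x j) • LinearMap.id := by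
  apply exteriorPower.linearMap_ext
  ext w : 1
  simp only [LinearMap.compAlternatingMap_apply, LinearMap.comp_apply, wedgeLeft_ιMulti,
    koszulD_ιMulti, LinearMap.smul_apply, LinearMap.id_apply]
  rw [Fin.sum_univ_succ, Fin.sum_univ_zero, add_zero]
  simp only [Fin.val_zero, pow_zero, one_smul, Matrix.cons_val_zero]
  rfl

/-- Exterior multiplication by `v` is a homotopy from zero to multiplication by `∑ j, v j * x j`:
contracting the leading factor gives the scalar, and the other terms cancel in pairs. -/
theorem koszulD_comp_wedgeLeft_succ (x v : Fin r → A) (k : ℕ) :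
    koszulD x (k + 1) ∘ₗ wedgeLeft v (k + 1) + wedgeLeft v k ∘ₗ koszulD x k =
      (∑ j, v j * x j) • LinearMap.id := by
  apply exteriorPower.linearMap_ext
  ext w : 1
  simp only [LinearMap.compAlternatingMap_apply, LinearMap.comp_apply, LinearMap.add_apply,
    wedgeLeft_ιMulti, koszulD_ιMulti, LinearMap.smul_apply, LinearMap.id_apply, map_sum, map_zsmul,
    map_smul]
  rw [Fin.sum_univ_succ]
  simp only [Fin.val_zero, pow_zero, one_smul, Matrix.cons_val_zero, Fin.val_succ, pow_succ,
    Matrix.cons_val_succ]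
  rw [add_assoc, ← Finset.sum_add_distrib]
  refine (congrArg₂ (· + ·) rfl (Finset.sum_eq_zero fun i _ => ?_)).trans (add_zero _)
  · have : Fin.removeNth (α := fun _ => Fin r → A) i.succ (Matrix.vecCons v w) =
        Matrix.vecCons v (Fin.removeNth (α := fun _ => Fin r → A) i w) := by
      funext j
      refine Fin.cases ?_ (fun j => ?_) j <;> simp [Fin.removeNth]
    rw [this]
    simp

/-- Koszul cohomology is annihilated by the ideal generated by the sequence. -/
theorem smul_mem_koszulBoundaries {y : A} (hy : y ∈ Ideal.span (Set.range x)) {i : ℕ}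
    {φ : ⋀[A]^i (Fin r → A) →ₗ[A] M} (hφ : φ ∘ₗ koszulD x i = 0) :
    y • φ ∈ koszulBoundaries x M i := by
  obtain ⟨v, rfl⟩ := Ideal.mem_span_range_iff_exists_fun.1 hy
  cases i with
  | zero =>
    have := congrArg (fun f => φ ∘ₗ f) (koszulD_comp_wedgeLeft_zero x v)
    simp only [← LinearMap.comp_assoc, hφ, LinearMap.zero_comp, LinearMap.comp_smul,
      LinearMap.comp_id] at this
    exact mem_koszulBoundaries_zero.2 this.symm
  | succ k =>
    have := congrArg (fun f => φ ∘ₗ f) (koszulD_comp_wedgeLeft_succ x v k)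
    simp only [LinearMap.comp_add, ← LinearMap.comp_assoc, hφ, LinearMap.zero_comp,
      LinearMap.comp_smul, LinearMap.comp_id, zero_add] at this
    exact mem_koszulBoundaries_succ.2 ⟨_, this⟩

/-- A regular sequence of length `n` in `(x)` makes the Koszul cohomology vanish below `n`. -/
theorem koszulVanishesBelow_of_isWeaklyRegular {rs : List A}
    (hrs : ∀ y ∈ rs, y ∈ Ideal.span (Set.range x)) (hreg : IsWeaklyRegular M rs) :
    KoszulVanishesBelow x M rs.length := by
  induction rs generalizing M with
  | nil => intro i hi; simp at hi
  | cons y rs ih =>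
    obtain ⟨hy, hrs'⟩ := (isWeaklyRegular_cons_iff M y rs).1 hreg
    have hv := ih (fun z hz => hrs z (List.mem_cons_of_mem _ hz)) hrs'
    intro i hi φ hφ
    have hyφ := smul_mem_koszulBoundaries (hrs y List.mem_cons_self) hφ
    cases i with
    | zero =>
      rw [mem_koszulBoundaries_zero] at hyφ ⊢
      exact smul_linearMap_injective hy (by rw [hyφ, smul_zero])
    | succ k =>
      obtain ⟨ψ, hψ⟩ := mem_koszulBoundaries_succ.1 hyφ
      have hk : k < rs.length := by simpa using hi
      -- The coboundary of `ψ` is `y • φ`, so `ψ` is a cocycle modulo `y`, hence a coboundary there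
      -- by induction. Subtracting a lifted coboundary `θ` makes `ψ` divisible by `y`, and `y` can
      -- be cancelled.
      have hψ' := hv k hk ((y • (⊤ : Submodule A M)).mkQ ∘ₗ ψ) (by
        refine LinearMap.ext fun a => ?_
        have : y • φ a ∈ y • (⊤ : Submodule A M) :=
          Submodule.smul_mem_pointwise_smul _ _ _ trivial
        rw [LinearMap.comp_assoc, hψ]
        exact (Submodule.Quotient.mk_eq_zero _).2 this)
      obtain ⟨θ, hθ, hθ'⟩ : ∃ θ ∈ koszulBoundaries x M k,
          (y • (⊤ : Submodule A M)).mkQ ∘ₗ (ψ - θ) = 0 := by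
        cases k with
        | zero => exact ⟨0, zero_mem _, by simpa using mem_koszulBoundaries_zero.1 hψ'⟩
        | succ l =>
          obtain ⟨χ, hχ⟩ := mem_koszulBoundaries_succ.1 hψ'
          obtain ⟨χ', rfl⟩ := Module.projective_lifting_property
            (y • (⊤ : Submodule A M)).mkQ χ (Submodule.mkQ_surjective _)
          exact ⟨χ' ∘ₗ koszulD x l, ⟨χ', rfl⟩, by
            rw [LinearMap.comp_sub, ← LinearMap.comp_assoc, hχ, sub_self]⟩
      obtain ⟨ψ', hψ''⟩ := exists_eq_smul_of_mkQ_comp_eq_zero y _ hθ'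
      refine mem_koszulBoundaries_succ.2 ⟨ψ', smul_linearMap_injective hy ?_⟩
      rw [← LinearMap.smul_comp, ← hψ'', LinearMap.sub_comp, koszulBoundaries_comp_koszulD hθ,
        sub_zero, hψ]

theorem length_le_koszulGrade {a : Ideal A} {rs : List A} (hrs : ∀ y ∈ rs, y ∈ a)
    (hreg : IsWeaklyRegular M rs) : (rs.length : ℕ∞) ≤ koszulGrade a M := by
  refine le_trans ?_ (le_iSup₂_of_le rs.length rs.get (le_iSup_of_le (fun i => hrs _ ?_) le_rfl))
  · rw [natCast_le_koszulGradeSeq_iff]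
    refine koszulVanishesBelow_of_isWeaklyRegular (fun y hy => ?_) hreg
    obtain ⟨i, rfl⟩ := List.get_of_mem hy
    exact Ideal.subset_span ⟨i, rfl⟩
  · exact List.get_mem _ _

theorem koszulGrade_top : koszulGrade (⊤ : Ideal A) M = ⊤ := by
  refine ENat.eq_top_iff_forall_ge.2 fun n => ?_
  -- The one-term sequence 1 suffices: its cohomology is annihilated by 1.
  refine le_trans ?_ (le_iSup₂_of_le 1 (fun _ => 1) (le_iSup_of_le (fun _ => trivial) le_rfl))
  rw [natCast_le_koszulGradeSeq_iff]
  intro i _ φ hφ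
  simpa using smul_mem_koszulBoundaries (y := 1) (by simp [Ideal.span, Set.range_const]) hφ

/-- `H⁰(x; M) = 0` means that no nonzero element of `M` is annihilated by `x`. -/
theorem KoszulVanishesBelow.eq_zero (h : KoszulVanishesBelow x M 1) {m : M}
    (hm : ∀ j, x j • m = 0) : m = 0 := by
  have h0 := h 0 one_pos
    (exteriorPower.alternatingMapLinearEquiv (AlternatingMap.constOfIsEmpty A _ (Fin 0) m)) (by
      apply exteriorPower.linearMap_ext
      ext w : 1
      simp only [LinearMap.compAlternatingMap_apply, LinearMap.comp_apply, koszulD_ιMulti,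
        map_sum, map_zsmul, map_smul, exteriorPower.alternatingMapLinearEquiv_apply_ιMulti]
      simp [Finset.sum_smul, mul_smul, hm])
  have := LinearMap.congr_fun (mem_koszulBoundaries_zero.1 h0)
    (exteriorPower.ιMulti A 0 Fin.elim0)
  simpa using this

/-- Each division by an element of `rs` costs one degree of vanishing, which leaves `H⁰` of the
quotient by `rs` equal to zero. -/
theorem mem_smul_top_of_forall_smul_mem {rs : List A} (hreg : IsWeaklyRegular M rs)
    (h : KoszulVanishesBelow x M (rs.length + 1)) {m : M}
    (hm : ∀ j, x j • m ∈ Ideal.ofList rs • (⊤ : Submodule A M)) :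
    m ∈ Ideal.ofList rs • (⊤ : Submodule A M) := by
  induction rs generalizing M with
  | nil =>
    simp only [Ideal.ofList_nil, Submodule.bot_smul, Submodule.mem_bot] at hm ⊢
    exact h.eq_zero hm
  | cons y rs ih =>
    obtain ⟨hy, hrs⟩ := (isWeaklyRegular_cons_iff M y rs).1 hreg
    have key (a : M) : a ∈ Ideal.ofList (y :: rs) • (⊤ : Submodule A M) ↔
        (y • (⊤ : Submodule A M)).mkQ a ∈
          Ideal.ofList rs • (⊤ : Submodule A (QuotSMulTop y M)) := by
      rw [← (Submodule.map_mkQ_eq_top (p := y • (⊤ : Submodule A M)) (p' := ⊤)).2 (by simp),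
        ← Submodule.map_smul'', ← Submodule.mem_comap, Submodule.comap_map_mkQ,
        Ideal.ofList_cons_smul]
    rw [key]
    refine ih hrs (h.quotSMulTop hy) fun j => ?_
    rw [← map_smul, ← key]
    exact hm j

/-- A prime minimal over a regular sequence of length `n` bounds the Koszul grade of every ideal
that it contains by `n`. -/
theorem koszulGrade_le_of_mem_minimalPrimes {a q : Ideal A} {rs : List A}
    (hreg : IsWeaklyRegular A rs) (hq : q ∈ (Ideal.ofList rs).minimalPrimes) (haq : a ≤ q) :
    koszulGrade a A ≤ rs.length := by
  refine iSup_le fun r => iSup₂_le fun x hx => ?_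
  by_contra! hlt
  have hv : KoszulVanishesBelow x A (rs.length + 1) :=
    natCast_le_koszulGradeSeq_iff.1 (by simpa using Order.add_one_le_of_lt hlt)
  have step : ∀ m, (∀ j, x j * m ∈ Ideal.ofList rs) → m ∈ Ideal.ofList rs := by
    intro m hm
    have := mem_smul_top_of_forall_smul_mem hreg hv (m := m)
    simp only [smul_eq_mul, Ideal.mul_top] at this
    exact this hm
  -- Iterating the colon property passes from `(x)` to all its powers. Minimality of `q` supplies an
  -- element outside `q` that some power of `(x)` multiplies into the ideal of `rs`, a
  -- contradiction.
  have step' : ∀ (n : ℕ) (m : A), (∀ a ∈ Ideal.span (Set.range x) ^ n, a * m ∈ Ideal.ofList rs) →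
      m ∈ Ideal.ofList rs := by
    intro n
    induction n with
    | zero => intro m hm; simpa using hm 1 (by simp)
    | succ n ih =>
      intro m hm
      refine step m fun j => ih _ fun a ha => ?_
      rw [← mul_assoc]
      refine hm _ ?_
      rw [pow_succ]
      exact Ideal.mul_mem_mul ha (Ideal.subset_span ⟨j, rfl⟩)
  have := hq.1.1
  choose s n hs hn using fun j => exists_mul_pow_mem_of_mem_minimalPrimes hq (haq (hx j))
  have hprod : ∏ j, s j ∉ q := fun h =>
    let ⟨j, _, hj⟩ := (Ideal.IsPrime.prod_mem_iff).1 h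
    hs j hj
  obtain ⟨N, hN⟩ := Ideal.exists_pow_le_of_le_radical_of_fg
    (I := Ideal.span (Set.range x)) (J := (Ideal.ofList rs).colon {∏ j, s j}) (by
      rw [Ideal.span_le]
      rintro _ ⟨j, rfl⟩
      refine ⟨n j, ?_⟩
      rw [Submodule.mem_colon_singleton, smul_eq_mul, mul_comm]
      exact Ideal.mem_of_dvd _ (mul_dvd_mul_right (Finset.dvd_prod_of_mem s (Finset.mem_univ j)) _)
        (hn j)) (Submodule.fg_span (Set.finite_range x))
  exact hprod (hq.1.2 (step' N _ fun a ha => Submodule.mem_colon_singleton.1 (hN ha)))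

end KoszulVanishing

/-! ### Depth, dimension and unmixedness in Noetherian local rings. -/

section Unmixedness

/-- A chain of primes above `J` can be prolonged below its smallest member, whose height is at least
that of `J`. -/
theorem ringKrullDim_quotient_add_height_le {A : Type u} [CommRing A] (J : Ideal A) :
    ringKrullDim (A ⧸ J) + J.height ≤ ringKrullDim A := by
  by_cases hJ : J = ⊤
  · rw [hJ, ringKrullDim_eq_bot_of_subsingleton]
    simp
  have hne : Nonempty (PrimeSpectrum.zeroLocus (R := A) J) := by
    rwa [Set.nonempty_coe_sort, Set.nonempty_iff_ne_empty, ne_eq,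
      PrimeSpectrum.zeroLocus_empty_iff_eq_top]
  have : Nonempty (PrimeSpectrum A) := ⟨hne.some.1⟩
  rw [ringKrullDim_quotient, Order.krullDim_eq_iSup_length, ringKrullDim,
    Order.krullDim_eq_iSup_height_add_coheight_of_nonempty, ← WithBot.coe_add, WithBot.coe_le_coe,
    ENat.iSup_add, iSup_le_iff]
  intro l
  refine le_trans ?_ (le_iSup _ l.head.1)
  rw [add_comm, ← PrimeSpectrum.height_eq_orderHeight]
  gcongr
  · exact l.head.2
  · exact Order.length_le_coheight (p := l.map Subtype.val fun _ _ h => h) le_rfl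

/-- Lets the annihilator record the elements already divided out in
`isWeaklyRegular_of_ringKrullDim_quotient_add_le`. -/
theorem le_annihilator_quotSMulTop {A : Type u} [CommRing A] {M : Type v} [AddCommGroup M]
    [Module A M] (y : A) :
    Module.annihilator A M ≤ Module.annihilator A (QuotSMulTop y M) ∧
      y ∈ Module.annihilator A (QuotSMulTop y M) := by
  refine ⟨LinearMap.annihilator_le_of_surjective (y • (⊤ : Submodule A M)).mkQ
    (Submodule.mkQ_surjective _), Module.mem_annihilator.2 fun m => ?_⟩
  obtain ⟨m, rfl⟩ := Submodule.mkQ_surjective _ m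
  rw [← map_smul, Submodule.mkQ_apply, Submodule.Quotient.mk_eq_zero]
  exact Submodule.smul_mem_pointwise_smul _ _ _ trivial

variable {A : Type u} [CommRing A] [IsLocalRing A] [IsNoetherianRing A] {r : ℕ} {x : Fin r → A}
  {M : Type v} [AddCommGroup M] [Module A M] [Module.Finite A M]

/-- Otherwise prime avoidance puts the maximal ideal inside one of the finitely many associated
primes, so it kills a nonzero element, against the vanishing of `H⁰`. -/
theorem exists_isSMulRegular_mem_maximalIdeal (hx : Ideal.span (Set.range x) = maximalIdeal A)
    (h : KoszulVanishesBelow x M 1) : ∃ z ∈ maximalIdeal A, IsSMulRegular M z := by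
  by_contra! hcon
  have hsub : (maximalIdeal A : Set A) ⊆ ⋃ p ∈ associatedPrimes A M, (p : Set A) := by
    rw [biUnion_associatedPrimes_eq_compl_regular A M]
    exact fun z hz => hcon z hz
  have hfin := associatedPrimes.finite A M
  obtain ⟨p, hp, hmp⟩ := (Ideal.subset_union_prime (s := hfin.toFinset) (f := id) ⊤ ⊤
    (fun i hi _ _ => ((Set.Finite.mem_toFinset _).1 hi).1)).1 (by simpa using hsub)
  obtain ⟨hprime, m, hm⟩ := isAssociatedPrime_iff.1 ((Set.Finite.mem_toFinset _).1 hp)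
  refine hprime.ne_top ?_
  have : m = 0 := h.eq_zero fun j => by
    have hj : x j ∈ p := hmp (hx ▸ Ideal.subset_span ⟨j, rfl⟩)
    rw [hm, Submodule.mem_colon_singleton] at hj
    simpa using hj
  simp [hm, this]

/-- An associated prime of `M` lies strictly below an associated prime of `M / zM` that
contains `z`. -/
theorem exists_mem_associatedPrimes_quotSMulTop {z : A} (hz : z ∈ maximalIdeal A)
    (hreg : IsSMulRegular M z) {p : Ideal A} (hp : p ∈ associatedPrimes A M) :
    z ∉ p ∧ ∃ q ∈ associatedPrimes A (QuotSMulTop z M), p ≤ q ∧ z ∈ q := by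
  obtain ⟨hprime, m, hm⟩ := isAssociatedPrime_iff.1 hp
  have hmem (a : A) : a ∈ p ↔ a • m = 0 := by
    rw [hm, Submodule.mem_colon_singleton, Submodule.mem_bot]
  have hm0 : m ≠ 0 := by
    rintro rfl
    exact hprime.ne_top ((Ideal.eq_top_iff_one _).2 ((hmem 1).2 (smul_zero _)))
  refine ⟨fun hzp => hm0 (hreg (by simpa using (hmem z).1 hzp)), ?_⟩
  -- `N` is the submodule killed by `p`. If it lay in `zM`, regularity of `z` would give `N = zN`,
  -- and Nakayama `N = 0`. So some `n` in `N` has a nonzero class modulo `z`, killed by both `p` and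
  -- `z`.
  let N : Submodule A M := ⨅ a ∈ p, LinearMap.ker (LinearMap.lsmul A M a)
  have hN (n : M) : n ∈ N ↔ ∀ a ∈ p, a • n = 0 := by simp [N]
  obtain ⟨n, hnN, hn⟩ : ∃ n ∈ N, n ∉ z • (⊤ : Submodule A M) := by
    by_contra! hle
    have hNbot : N = ⊥ := by
      refine Submodule.eq_bot_of_le_smul_of_le_jacobson_bot (Ideal.span {z}) N
        (IsNoetherian.noetherian N) ?_ ?_
      · intro n hn
        obtain ⟨n', -, rfl⟩ := hle n hn
        refine Submodule.smul_mem_smul (Ideal.mem_span_singleton_self z) ((hN _).2 fun a ha => ?_)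
        refine hreg ?_
        have := (hN _).1 hn a ha
        simp only [DistribSMul.toLinearMap_apply] at this
        simp only [smul_zero]
        rwa [smul_comm]
      · rw [Ideal.span_singleton_le_iff_mem, IsLocalRing.jacobson_eq_maximalIdeal _ bot_ne_top]
        exact hz
    have : m ∈ N := (hN m).2 fun a ha => (hmem a).1 ha
    rw [hNbot] at this
    exact hm0 this
  obtain ⟨q, hq, hle⟩ := exists_le_isAssociatedPrime_of_isNoetherianRing A
    ((z • (⊤ : Submodule A M)).mkQ n) (by simpa using hn)
  refine ⟨q, hq, fun a ha => hle ?_, hle ?_⟩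
  · rw [Submodule.mem_colon_singleton, ← map_smul, (hN n).1 hnN a ha, map_zero]
    exact zero_mem _
  · rw [Submodule.mem_colon_singleton, ← map_smul, Submodule.mem_bot, Submodule.mkQ_apply,
      Submodule.Quotient.mk_eq_zero]
    exact Submodule.smul_mem_pointwise_smul _ _ _ trivial

/-- The Koszul form of depth M ≤ dim A/p. Dividing by a regular `z` lowers the depth bound by one
and replaces `p` by an associated prime containing `p` and `z`, so the dimension drops by at least
one. -/
theorem le_ringKrullDim_quotient_of_mem_associatedPrimes
    (hx : Ideal.span (Set.range x) = maximalIdeal A) {k : ℕ} (h : KoszulVanishesBelow x M k)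
    {p : Ideal A} (hp : p ∈ associatedPrimes A M) : (k : WithBot ℕ∞) ≤ ringKrullDim (A ⧸ p) := by
  induction k generalizing M p with
  | zero =>
    have := hp.1
    exact ringKrullDim_nonneg_of_nontrivial
  | succ k ih =>
    obtain ⟨z, hz, hreg⟩ := exists_isSMulRegular_mem_maximalIdeal hx (h.mono (by omega))
    obtain ⟨hzp, q, hq, hpq, hzq⟩ := exists_mem_associatedPrimes_quotSMulTop hz hreg hp
    have hk := ih (h.quotSMulTop hreg) hq
    have := hp.1
    have hdim := ringKrullDim_quotient_succ_le_of_nonZeroDivisor (R := A ⧸ p)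
      (r := Ideal.Quotient.mk p z) (mem_nonZeroDivisors_of_ne_zero
        (by rwa [Ne, Ideal.Quotient.eq_zero_iff_mem]))
    have hle : ringKrullDim (A ⧸ q) ≤
        ringKrullDim ((A ⧸ p) ⧸ Ideal.span {Ideal.Quotient.mk p z}) := by
      refine ringKrullDim_le_of_surjective (Ideal.Quotient.lift _ (Ideal.Quotient.factor hpq)
        fun a ha => ?_) (Ideal.Quotient.lift_surjective_of_surjective _ _
          (Ideal.Quotient.factor_surjective hpq))
      have : Ideal.span {Ideal.Quotient.mk p z} ≤ RingHom.ker (Ideal.Quotient.factor hpq) := by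
        rw [Ideal.span_singleton_le_iff_mem, RingHom.mem_ker, Ideal.Quotient.factor_mk,
          Ideal.Quotient.eq_zero_iff_mem]
        exact hzq
      exact this ha
    calc ((k + 1 : ℕ) : WithBot ℕ∞) = k + 1 := by push_cast; rfl
      _ ≤ _ := add_le_add_left (hk.trans hle) 1
      _ ≤ _ := hdim

/-- A zero divisor `y` would lie in an associated prime `p` with dim A/p ≥ n, against the dimension
bound for `i = 1`. Bounding over primes above the annihilator lets the induction change `M` but keep
the ring. -/
theorem isWeaklyRegular_of_ringKrullDim_quotient_add_le
    (hx : Ideal.span (Set.range x) = maximalIdeal A) {n : ℕ} (h : KoszulVanishesBelow x M n)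
    {ys : List A}
    (hys : ∀ i ≤ ys.length, ∀ p : Ideal A, p.IsPrime → Module.annihilator A M ≤ p →
      (∀ y ∈ ys.take i, y ∈ p) → ringKrullDim (A ⧸ p) + i ≤ n) : IsWeaklyRegular M ys := by
  induction ys generalizing M n with
  | nil => exact IsWeaklyRegular.nil A M
  | cons y ys ih =>
    have hpos {p : Ideal A} (hp : p.IsPrime) : 0 ≤ ringKrullDim (A ⧸ p) :=
      ringKrullDim_nonneg_of_nontrivial
    have hy : IsSMulRegular M y := by
      by_contra hy
      have : y ∈ ⋃ p ∈ associatedPrimes A M, (p : Set A) := by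
        rw [biUnion_associatedPrimes_eq_compl_regular A M]
        exact hy
      simp only [Set.mem_iUnion] at this
      obtain ⟨p, hp, hyp⟩ := this
      have h1 := le_ringKrullDim_quotient_of_mem_associatedPrimes hx h hp
      have h2 := hys 1 (by simp) p hp.1
        (by simpa [Submodule.annihilator_top] using IsAssociatedPrime.annihilator_le hp)
        (by simpa using hyp)
      have h3 := (add_le_add_left h1 _).trans h2
      norm_cast at h3
      omega
    refine IsWeaklyRegular.cons hy (ih (n := n - 1) ?_ fun i hi p hp hann hpi => ?_)
    -- For `n = 0` the truncated `n - 1` is again 0, and there is nothing to prove.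
    · obtain _ | n := n
      · exact fun i hi => absurd hi (by omega)
      · exact h.quotSMulTop hy
    · have hle := hys (i + 1) (by simpa using hi) p hp
        ((le_annihilator_quotSMulTop y).1.trans hann) (by
          simpa using ⟨hann (le_annihilator_quotSMulTop y).2, hpi⟩)
      have := hpos hp
      generalize ringKrullDim (A ⧸ p) = D at hle this ⊢
      induction D with
      | bot => simp at this
      | coe D =>
        induction D with
        | top =>
          have h' : ((⊤ + ((i + 1 : ℕ) : ℕ∞) : ℕ∞) : WithBot ℕ∞) ≤ ((n : ℕ∞) : WithBot ℕ∞) := hle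
          rw [top_add, WithBot.coe_le_coe, top_le_iff] at h'
          exact absurd h' (ENat.natCast_ne_top n)
        | coe D =>
          have h' : D + (i + 1) ≤ n := by exact_mod_cast hle
          have : D + i ≤ n - 1 := by omega
          have h'' : (((D + i : ℕ) : ℕ∞) : WithBot ℕ∞) ≤ ((n - 1 : ℕ) : ℕ∞) :=
            WithBot.coe_le_coe.2 (Nat.cast_le.2 this)
          rwa [Nat.cast_add, WithBot.coe_add] at h''

theorem mem_maximalIdeal_of_ofList_ne_top {A : Type u} [CommRing A] [IsLocalRing A] {ys : List A}
    (hys : Ideal.ofList ys ≠ ⊤) {y : A}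
    (hy : y ∈ ys) : y ∈ maximalIdeal A :=
  le_maximalIdeal hys (Ideal.subset_span hy)

/-- Descending induction on `i`: the full list is covered by the height inequality, and each element
of the maximal ideal cuts the dimension by at most one. -/
theorem ringKrullDim_quotient_ofList_take_add_le {ys : List A} (hne : Ideal.ofList ys ≠ ⊤)
    (hht : (ys.length : ℕ∞) ≤ (Ideal.ofList ys).height) {i : ℕ} (hi : i ≤ ys.length) :
    ringKrullDim (A ⧸ Ideal.ofList (ys.take i)) + i ≤ ringKrullDim A := by
  induction hi using Nat.decreasingInduction with
  | self =>
    rw [List.take_length]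
    refine le_trans ?_ (ringKrullDim_quotient_add_height_le (Ideal.ofList ys))
    gcongr
    exact_mod_cast hht
  | of_succ i hi ih =>
    refine le_trans ?_ ih
    set J := Ideal.ofList (ys.take i)
    have hmem : Ideal.Quotient.mk J ys[i] ∈ Ring.jacobson (A ⧸ J) := by
      rw [Ring.jacobson_eq_sInf_isMaximal, Submodule.mem_sInf]
      intro (P : Ideal (A ⧸ J)) (hP : P.IsMaximal)
      have : (P.comap (Ideal.Quotient.mk J)).IsMaximal :=
        Ideal.comap_isMaximal_of_surjective _ Ideal.Quotient.mk_surjective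
      rw [← Ideal.mem_comap, eq_maximalIdeal this]
      exact mem_maximalIdeal_of_ofList_ne_top hne (List.getElem_mem hi)
    have h1 := ringKrullDim_le_ringKrullDim_quotient_add_encard {Ideal.Quotient.mk J ys[i]}
      (by simpa using hmem)
    have h2 : ringKrullDim ((A ⧸ J) ⧸ Ideal.span {Ideal.Quotient.mk J ys[i]}) =
        ringKrullDim (A ⧸ Ideal.ofList (ys.take (i + 1))) := by
      rw [List.take_succ_eq_append_getElem hi, Ideal.ofList_append, Ideal.ofList_singleton,
        ← Set.image_singleton, ← Ideal.map_span]
      exact ringKrullDim_eq_of_ringEquiv (DoubleQuot.quotQuotEquivQuotSup _ _)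
    rw [h2, Set.encard_singleton] at h1
    calc _ ≤ _ := add_le_add_left h1 _
      _ = _ := by push_cast; rw [add_assoc, add_comm 1]

/-- In a local ring of depth equal to its dimension, elements that generate a proper ideal of
height at least their number form a regular sequence. -/
theorem isWeaklyRegular_of_length_le_height (hx : Ideal.span (Set.range x) = maximalIdeal A)
    {d : ℕ} (hd : ringKrullDim A = d) (h : KoszulVanishesBelow x A d) {ys : List A}
    (hne : Ideal.ofList ys ≠ ⊤) (hht : (ys.length : ℕ∞) ≤ (Ideal.ofList ys).height) :
    IsWeaklyRegular A ys := by
  refine isWeaklyRegular_of_ringKrullDim_quotient_add_le hx h fun i hi p hp _ hpi => ?_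
  rw [← hd]
  refine le_trans ?_ (ringKrullDim_quotient_ofList_take_add_le hne hht hi)
  gcongr
  exact ringKrullDim_le_of_surjective (Ideal.Quotient.factor (Ideal.span_le.2 hpi))
    (Ideal.Quotient.factor_surjective _)

end Unmixedness

/-! ### Regular local rings are domains and Cohen-Macaulay. -/

section RegularLocal

theorem map_maximalIdeal_quotient_eq {A : Type u} [CommRing A] [IsLocalRing A] (I : Ideal A)
    [IsLocalRing (A ⧸ I)] :
    (maximalIdeal A).map (Ideal.Quotient.mk I) = maximalIdeal (A ⧸ I) := by
  refine le_antisymm (Ideal.map_le_iff_le_comap.2 ?_) fun a ha => ?_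
  · exact (eq_maximalIdeal (Ideal.comap_isMaximal_of_surjective _
      Ideal.Quotient.mk_surjective)).ge
  · obtain ⟨a, rfl⟩ := Ideal.Quotient.mk_surjective a
    refine Ideal.mem_map_of_mem _ ((mem_maximalIdeal a).2 fun h => ?_)
    exact (mem_maximalIdeal _).1 ha (h.map _)

/-- Dividing out an element of `𝔪 \ 𝔪²` lowers the embedding dimension. -/
theorem spanFinrank_map_maximalIdeal_add_one_le {A : Type u} [CommRing A] [IsLocalRing A]
    [IsNoetherianRing A] {z : A} (hz : z ∈ maximalIdeal A) (hz2 : z ∉ maximalIdeal A ^ 2) :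
    ((maximalIdeal A).map (Ideal.Quotient.mk (Ideal.span {z}))).spanFinrank + 1 ≤
      (maximalIdeal A).spanFinrank := by
  let c := (maximalIdeal A).toCotangent
  have hzc : c ⟨z, hz⟩ ≠ 0 := by
    rwa [Ne, Ideal.toCotangent_eq_zero]
  have hli : LinearIndepOn (ResidueField A) id {c ⟨z, hz⟩} := by
    simpa using hzc
  -- Complete the class of `z` to a basis of the cotangent space. By Nakayama lifts of the basis
  -- generate the maximal ideal, and the generator `z` dies in the quotient.
  let s := hli.extend (Set.subset_univ _)
  have hs : LinearIndepOn (ResidueField A) id s := hli.linearIndepOn_extend _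
  have hspan : Submodule.span (ResidueField A) s = ⊤ := by
    have := hli.span_extend_eq_span (Set.subset_univ _)
    simpa using this
  have hzs : c ⟨z, hz⟩ ∈ s := hli.subset_extend _ rfl
  have hfin : s.Finite := hs.setFinite
  have hcard : s.ncard = (maximalIdeal A).spanFinrank := by
    have := hfin.fintype
    rw [spanFinrank_maximalIdeal_eq_finrank_cotangentSpace, ← finrank_top,
      Set.ncard_eq_toFinset_card', ← finrank_span_set_eq_card hs, hspan]
  let g := Function.surjInv (Ideal.toCotangent_surjective (maximalIdeal A))
  let T : Set (maximalIdeal A) := insert ⟨z, hz⟩ (g '' (s \ {c ⟨z, hz⟩}))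
  have hT : Submodule.span A T = ⊤ := by
    rw [← CotangentSpace.span_image_eq_top_iff, Set.image_insert_eq, Set.image_image]
    simp only [g, Function.surjInv_eq, Set.image_id']
    rw [Set.insert_sdiff_self_of_mem hzs]
    exact hspan
  have hm : maximalIdeal A = Ideal.span
      (insert z ((fun a => (g a : A)) '' (s \ {c ⟨z, hz⟩}))) := by
    have := congrArg (Submodule.map (maximalIdeal A).subtype) hT
    rw [Submodule.map_span, Submodule.map_top, Submodule.range_subtype, Set.image_insert_eq,
      Set.image_image] at this
    exact this.symm
  have hmap : (maximalIdeal A).map (Ideal.Quotient.mk (Ideal.span {z})) =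
      Submodule.span _ ((fun a => Ideal.Quotient.mk (Ideal.span {z}) (g a)) ''
        (s \ {c ⟨z, hz⟩})) := by
    conv_lhs => rw [hm]
    rw [Ideal.map_span, Set.image_insert_eq, Set.image_image,
      Ideal.Quotient.eq_zero_iff_mem.2 (Ideal.mem_span_singleton_self z), Ideal.span_insert_zero]
  have hfin' : (s \ {c ⟨z, hz⟩}).Finite := hfin.subset Set.sdiff_subset
  rw [hmap, ← hcard, ← Set.ncard_sdiff_singleton_add_one hzs hfin]
  gcongr
  exact (Submodule.spanFinrank_span_le_ncard_of_finite (hfin'.image _)).trans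
    (Set.ncard_image_le hfin')

/-- Prime avoidance, which tolerates the non-prime ideal `𝔪²`. Containment of `𝔪` in `𝔪²` forces `𝔪
= 0` by Nakayama, and containment in a minimal prime forces height 0. -/
theorem exists_mem_maximalIdeal_notMem_minimalPrimes {A : Type u} [CommRing A] [IsLocalRing A]
    [IsNoetherianRing A] (h : 0 < ringKrullDim A) :
    ∃ z ∈ maximalIdeal A, z ∉ maximalIdeal A ^ 2 ∧ ∀ P ∈ minimalPrimes A, z ∉ P := by
  classical
  by_contra! hcon
  have hfin := minimalPrimes.finite_of_isNoetherianRing A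
  have hht : (maximalIdeal A).height ≠ 0 := by
    intro h0
    rw [← IsLocalRing.maximalIdeal_height_eq_ringKrullDim, h0] at h
    simp at h
  obtain ⟨P, hP, hle⟩ := (Ideal.subset_union_prime
    (s := insert (maximalIdeal A ^ 2) hfin.toFinset) (f := id) (maximalIdeal A ^ 2)
    (maximalIdeal A ^ 2) (fun i hi hi' _ => by
      have := (Finset.mem_insert.1 hi).resolve_left hi'
      exact ((Set.Finite.mem_toFinset _).1 this).1.1)).1 (fun z hz => by
        simp only [Finset.coe_insert, Set.Finite.coe_toFinset, Set.mem_insert_iff, id,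
          Set.iUnion_iUnion_eq_or_left, Set.mem_union, Set.mem_iUnion]
        by_cases hz2 : z ∈ maximalIdeal A ^ 2
        · exact Or.inl hz2
        · obtain ⟨P, hP, hzP⟩ := hcon z hz hz2
          exact Or.inr ⟨P, hP, hzP⟩)
  rcases Finset.mem_insert.1 hP with rfl | hP
  · have hbot : maximalIdeal A = ⊥ := by
      refine Submodule.eq_bot_of_le_smul_of_le_jacobson_bot (maximalIdeal A) _
        (IsNoetherian.noetherian _) ?_ (IsLocalRing.jacobson_eq_maximalIdeal _ bot_ne_top).ge
      rw [smul_eq_mul, ← pow_two]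
      exact hle
    rw [hbot, Ideal.height_bot] at hht
    exact hht rfl
  · rw [Set.Finite.mem_toFinset] at hP
    have hPm : P = maximalIdeal A := le_antisymm (le_maximalIdeal hP.1.1.ne_top) hle
    rw [hPm] at hP
    exact hht (Ideal.height_eq_zero_iff.2 hP)

/-- Both claims go through one induction. For `z` in `𝔪 \ 𝔪²` outside the minimal primes, A/z is
regular of dimension d, so `(z)` is prime by induction. This makes `A` a domain, hence `z` regular,
and lifts of the sequence from A/z follow `z`. -/
theorem exists_isWeaklyRegular_of_ringKrullDim_eq (d : ℕ) :
    ∀ (A : Type u) [CommRing A] [IsRegularLocalRing A], ringKrullDim A = d →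
      IsDomain A ∧ ∃ rs : List A, rs.length = d ∧ (∀ y ∈ rs, y ∈ maximalIdeal A) ∧
        IsWeaklyRegular A rs := by
  induction d with
  | zero =>
    intro A _ _ hd
    have hbot : maximalIdeal A = ⊥ := by
      have := IsRegularLocalRing.spanFinrank_maximalIdeal (R := A)
      rw [hd] at this
      exact (Submodule.spanFinrank_eq_zero_iff_eq_bot (IsNoetherian.noetherian _)).1
        (by exact_mod_cast this)
    have := (IsLocalRing.isField_iff_maximalIdeal_eq.2 hbot)
    exact ⟨this.isDomain, [], rfl, by simp, IsWeaklyRegular.nil A A⟩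
  | succ d ih =>
    intro A _ _ hd
    obtain ⟨z, hz, hz2, hzP⟩ := exists_mem_maximalIdeal_notMem_minimalPrimes (A := A)
      (by rw [hd]; exact_mod_cast Nat.succ_pos d)
    have : Nontrivial (A ⧸ Ideal.span {z}) := Ideal.Quotient.nontrivial_iff.2 fun htop =>
      (maximalIdeal.isMaximal A).ne_top (top_le_iff.1 (htop ▸
        (Ideal.span_singleton_le_iff_mem _).2 hz))
    have hloc : IsLocalRing (A ⧸ Ideal.span {z}) :=
      IsLocalRing.of_surjective' _ Ideal.Quotient.mk_surjective
    have hrank := spanFinrank_map_maximalIdeal_add_one_le hz hz2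
    rw [map_maximalIdeal_quotient_eq] at hrank
    have hrank' : (maximalIdeal A).spanFinrank = d + 1 := by
      have := IsRegularLocalRing.spanFinrank_maximalIdeal (R := A)
      rw [hd] at this
      exact_mod_cast this
    have hrank'' : ((maximalIdeal (A ⧸ Ideal.span {z})).spanFinrank : WithBot ℕ∞) ≤ d := by
      have : (maximalIdeal (A ⧸ Ideal.span {z})).spanFinrank ≤ d := by omega
      exact_mod_cast this
    have hdim : (d : WithBot ℕ∞) ≤ ringKrullDim (A ⧸ Ideal.span {z}) := by
      have h1 := Ideal.height_le_ringKrullDim_quotient_add_one hz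
      rw [IsLocalRing.maximalIdeal_height_eq_ringKrullDim, hd] at h1
      generalize ringKrullDim (A ⧸ Ideal.span {z}) = D at h1 ⊢
      induction D with
      | bot => simp at h1
      | coe D =>
        induction D with
        | top => exact WithBot.coe_le_coe.2 le_top
        | coe D =>
          have h2 : d + 1 ≤ D + 1 := by exact_mod_cast h1
          have h3 : (((d : ℕ) : ℕ∞) : WithBot ℕ∞) ≤ (D : ℕ∞) :=
            WithBot.coe_le_coe.2 (Nat.cast_le.2 (Nat.le_of_succ_le_succ h2))
          exact h3
    have hregq : IsRegularLocalRing (A ⧸ Ideal.span {z}) :=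
      IsRegularLocalRing.of_spanFinrank_maximalIdeal_le _ (hrank''.trans hdim)
    obtain ⟨hdom, rs, hlen, hrs, hreg⟩ := ih (A ⧸ Ideal.span {z}) (le_antisymm
      ((ringKrullDim_le_spanFinrank_maximalIdeal _).trans hrank'') hdim)
    have hzprime : (Ideal.span {z}).IsPrime := (Ideal.Quotient.isDomain_iff_prime _).1 hdom
    obtain ⟨P, hP, hPz⟩ := Ideal.exists_minimalPrimes_le (bot_le : ⊥ ≤ Ideal.span {z})
    have hPprime := hP.1.1
    -- Elements of `P` are multiples of `z`, and `z` is not in `P`, so `P = zP` and Nakayama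
    -- applies.
    have hPbot : P = ⊥ := by
      refine Submodule.eq_bot_of_le_smul_of_le_jacobson_bot (Ideal.span {z}) P
        (IsNoetherian.noetherian _) (fun a ha => ?_) ?_
      · obtain ⟨b, rfl⟩ := Ideal.mem_span_singleton'.1 (hPz ha)
        rw [smul_eq_mul, mul_comm b]
        exact Ideal.mul_mem_mul (Ideal.mem_span_singleton_self z)
          ((hPprime.mem_or_mem ha).resolve_right (hzP P hP))
      · rw [Ideal.span_singleton_le_iff_mem, IsLocalRing.jacobson_eq_maximalIdeal _ bot_ne_top]
        exact hz
    have hdomA : IsDomain A := by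
      rw [hPbot] at hPprime
      exact IsDomain.of_bot_isPrime A
    refine ⟨hdomA, z :: rs.map (Function.surjInv Ideal.Quotient.mk_surjective), by simp [hlen],
      ?_, ?_⟩
    · intro y hy
      rcases List.mem_cons.1 hy with rfl | hy
      · exact hz
      · obtain ⟨b, hb, rfl⟩ := List.mem_map.1 hy
        have := hrs b hb
        rw [← Function.surjInv_eq Ideal.Quotient.mk_surjective b,
          ← map_maximalIdeal_quotient_eq] at this
        have h2 := Ideal.mem_comap.2 this
        rwa [Ideal.comap_map_of_surjective' _ Ideal.Quotient.mk_surjective, Ideal.mk_ker,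
          sup_eq_left.2 ((Ideal.span_singleton_le_iff_mem _).2 hz)] at h2
    · refine IsWeaklyRegular.cons ?_ ?_
      · refine IsSMulRegular.of_ne_zero ?_
        rintro rfl
        exact hz2 (zero_mem _)
      · rw [LinearEquiv.isWeaklyRegular_congr (Submodule.quotEquivOfEq (z • (⊤ : Submodule A A))
          (Ideal.span {z}) (by rw [← Submodule.ideal_span_singleton_smul]; simp)),
          ← isWeaklyRegular_map_algebraMap_iff (A ⧸ Ideal.span {z})]
        have hmap : (rs.map (Function.surjInv Ideal.Quotient.mk_surjective)).map
            (algebraMap A (A ⧸ Ideal.span {z})) = rs := by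
          rw [List.map_map]
          convert List.map_id rs
          exact funext fun b => Function.surjInv_eq Ideal.Quotient.mk_surjective b
        rw [hmap]
        exact hreg

theorem exists_ringKrullDim_eq_natCast (A : Type u) [CommRing A] [IsLocalRing A]
    [IsNoetherianRing A] : ∃ d : ℕ, ringKrullDim A = d := by
  rw [← IsLocalRing.maximalIdeal_height_eq_ringKrullDim]
  obtain ⟨d, hd⟩ := ENat.ne_top_iff_exists.1
    (Ideal.height_ne_top_of_isPrime (I := maximalIdeal A))
  exact ⟨d, by rw [← hd]; rfl⟩

theorem isDomain_of_isRegularLocalRing (A : Type u) [CommRing A] [IsRegularLocalRing A] :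
    IsDomain A :=
  let ⟨d, hd⟩ := exists_ringKrullDim_eq_natCast A
  (exists_isWeaklyRegular_of_ringKrullDim_eq d A hd).1

/-- Regular local rings are Cohen-Macaulay: elements that generate a proper ideal of height at
least their number form a regular sequence. -/
theorem IsRegularLocalRing.isWeaklyRegular_of_length_le_height {A : Type u} [CommRing A]
    [IsRegularLocalRing A] {ys : List A} (hne : Ideal.ofList ys ≠ ⊤)
    (hht : (ys.length : ℕ∞) ≤ (Ideal.ofList ys).height) : IsWeaklyRegular A ys := by
  obtain ⟨d, hd⟩ := exists_ringKrullDim_eq_natCast A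
  obtain ⟨-, rs, hlen, hrs, hreg⟩ := exists_isWeaklyRegular_of_ringKrullDim_eq d A hd
  obtain ⟨r, x, hx⟩ := Submodule.fg_iff_exists_fin_generating_family.1
    (IsNoetherian.noetherian (maximalIdeal A))
  refine NonNoetherianCM.isWeaklyRegular_of_length_le_height (x := x) hx hd ?_ hne hht
  rw [← hlen]
  exact koszulVanishesBelow_of_isWeaklyRegular (fun y hy => by
    rw [Ideal.span, hx]; exact hrs y hy) hreg

end RegularLocal

/-! ### Descent along the perfect closure by Frobenius powers. -/

section PerfectClosure

theorem isWeaklyRegular_self_iff {A : Type u} [CommRing A] {rs : List A} :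
    IsWeaklyRegular A rs ↔ ∀ (j : ℕ) (h : j < rs.length) (s : A),
      rs[j] * s ∈ Ideal.ofList (rs.take j) → s ∈ Ideal.ofList (rs.take j) := by
  rw [isWeaklyRegular_iff]
  refine forall₂_congr fun j hj => ?_
  rw [smul_eq_mul, Ideal.mul_top]
  exact isSMulRegular_quotient_iff_mem_of_smul_mem _ _

theorem le_height_iff {A : Type u} [CommRing A] {I : Ideal A} {n : ℕ∞} :
    n ≤ I.height ↔ ∀ P : Ideal A, P.IsPrime → I ≤ P → n ≤ P.height := by
  refine ⟨fun h P _ hP => h.trans (Ideal.height_mono hP), fun h => ?_⟩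
  rw [Ideal.height_eq_inf_minimalPrimes]
  exact le_iInf₂ fun P hP => h P hP.1.1 hP.1.2

variable {R : Type u} {S : Type v} [CommRing R] [CommRing S] (i : R →+* S)

/-- Valid for all large `e`, so that finitely many elements can share one exponent. -/
theorem eventually_exists_eq_pow (p : ℕ) [IsPRadical i p] (s : S) :
    ∀ᶠ e in atTop, ∃ t, i t = s ^ p ^ e := by
  obtain ⟨n, t, ht⟩ := IsPRadical.pow_mem i p s
  filter_upwards [eventually_ge_atTop n] with e he
  refine ⟨t ^ p ^ (e - n), ?_⟩
  rw [map_pow, ht, ← pow_mul, ← pow_add, Nat.add_sub_cancel' he]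

theorem eventually_exists_map_eq_map_pow (p : ℕ) [IsPRadical i p] (xs : List S) :
    ∀ᶠ e in atTop, ∃ rs : List R, rs.map i = xs.map (· ^ p ^ e) := by
  induction xs with
  | nil => exact Eventually.of_forall fun e => ⟨[], rfl⟩
  | cons x xs ih =>
    filter_upwards [ih, eventually_exists_eq_pow i p x] with e ⟨rs, hrs⟩ ⟨t, ht⟩
    exact ⟨t :: rs, by simp [hrs, ht]⟩

/-- Raising a combination of elements of `I` to the p^e-th power is additive, and for large `e`
brings its finitely many coefficients into `R`. -/
theorem eventually_exists_mem_map_iterateFrobenius (p : ℕ) [Fact p.Prime] [CharP R p]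
    [CharP S p] [IsPRadical i p] (I : Ideal R) {s : S} (hs : s ∈ I.map i) :
    ∀ᶠ e in atTop, ∃ t ∈ I.map (iterateFrobenius R p e), i t = s ^ p ^ e := by
  induction hs using Submodule.span_induction with
  | mem s hs =>
    obtain ⟨t, ht, rfl⟩ := hs
    exact Eventually.of_forall fun e =>
      ⟨t ^ p ^ e, Ideal.mem_map_of_mem (iterateFrobenius R p e) ht, map_pow _ _ _⟩
  | zero =>
    exact Eventually.of_forall fun e => ⟨0, zero_mem _, by
      rw [map_zero, zero_pow (pow_ne_zero _ (Fact.out : p.Prime).ne_zero)]⟩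
  | add s s' _ _ h h' =>
    filter_upwards [h, h'] with e ⟨t, ht, hts⟩ ⟨t', ht', hts'⟩
    exact ⟨t + t', add_mem ht ht', by rw [map_add, hts, hts', add_pow_char_pow]⟩
  | smul c s _ h =>
    filter_upwards [h, eventually_exists_eq_pow i p c] with e ⟨t, ht, hts⟩ ⟨c', hc'⟩
    exact ⟨c' * t, Ideal.mul_mem_left _ _ ht, by rw [map_mul, hts, hc', smul_eq_mul, mul_pow]⟩

theorem le_iff_comap_le_comap (p : ℕ) [Fact p.Prime] [IsPRadical i p]
    (I : Ideal S) {P : Ideal S} (hP : P.IsPrime) :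
    I ≤ P ↔ I.comap i ≤ P.comap i := by
  refine ⟨fun h => Ideal.comap_mono h, fun h s hs => ?_⟩
  obtain ⟨n, t, ht⟩ := IsPRadical.pow_mem i p s
  have : t ∈ P.comap i := h (by
    rw [Ideal.mem_comap, ht]
    exact Ideal.pow_mem_of_mem _ hs _ (pow_pos (Fact.out : p.Prime).pos _))
  rw [Ideal.mem_comap, ht] at this
  exact hP.mem_of_pow_mem _ this

theorem comap_surjective_of_isPRadical (p : ℕ) [Fact p.Prime] [IsPRadical i p]
    (hi : Function.Injective i) :
    Function.Surjective (PrimeSpectrum.comap i) := by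
  refine RingHom.IsIntegral.comap_surjective (fun s => ?_) hi
  obtain ⟨n, t, ht⟩ := IsPRadical.pow_mem i p s
  exact ⟨Polynomial.X ^ p ^ n - Polynomial.C t,
    Polynomial.monic_X_pow_sub_C t (pow_ne_zero _ (Fact.out : p.Prime).ne_zero), by simp [ht]⟩

/-- The spectra of a ring and of its perfect closure are isomorphic as ordered sets. -/
def primeSpectrumOrderIso (p : ℕ) [Fact p.Prime] [IsPRadical i p]
    (hi : Function.Injective i) : PrimeSpectrum S ≃o PrimeSpectrum R :=
  RelIso.ofSurjective (OrderEmbedding.ofMapLEIff (PrimeSpectrum.comap i) fun P Q =>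
    (le_iff_comap_le_comap i p P.asIdeal Q.isPrime).symm) (comap_surjective_of_isPRadical i p hi)

theorem height_comap_of_isPrime (p : ℕ) [Fact p.Prime] [IsPRadical i p]
    (hi : Function.Injective i) (P : Ideal S) [hP : P.IsPrime] :
    (P.comap i).height = P.height := by
  have h := Order.height_orderIso (primeSpectrumOrderIso i p hi) ⟨P, hP⟩
  rw [← PrimeSpectrum.height_eq_orderHeight, ← PrimeSpectrum.height_eq_orderHeight] at h
  exact h

theorem height_eq_of_forall_le_iff (p : ℕ) [Fact p.Prime] [IsPRadical i p]
    (hi : Function.Injective i) {a : Ideal S} {b : Ideal R}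
    (h : ∀ P : Ideal S, P.IsPrime → (a ≤ P ↔ b ≤ P.comap i)) : b.height = a.height := by
  refine eq_of_forall_le_iff fun n => ?_
  rw [le_height_iff, le_height_iff]
  refine ⟨fun hb P hP haP => ?_, fun ha Q hQ hbQ => ?_⟩
  · rw [← height_comap_of_isPrime i p hi]
    exact hb _ inferInstance ((h P hP).1 haP)
  · obtain ⟨P, hP⟩ := comap_surjective_of_isPRadical i p hi ⟨Q, hQ⟩
    obtain rfl : P.asIdeal.comap i = Q := congrArg PrimeSpectrum.asIdeal hP
    rw [height_comap_of_isPrime i p hi]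
    exact ha _ P.isPrime ((h _ P.isPrime).2 hbQ)

theorem height_comap (p : ℕ) [Fact p.Prime] [IsPRadical i p]
    (hi : Function.Injective i) (a : Ideal S) :
    (a.comap i).height = a.height :=
  height_eq_of_forall_le_iff i p hi fun _ hP => le_iff_comap_le_comap i p a hP

theorem ofList_le_iff_of_map_eq_map_pow {p : ℕ} [Fact p.Prime] {xs : List S} {rs : List R} {e : ℕ}
    (h : rs.map i = xs.map (· ^ p ^ e)) {P : Ideal S} (hP : P.IsPrime) :
    Ideal.ofList xs ≤ P ↔ Ideal.ofList rs ≤ P.comap i := by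
  rw [← Ideal.map_le_iff_le_comap, Ideal.map_ofList, h, Ideal.ofList, Ideal.ofList, Ideal.span_le,
    Ideal.span_le]
  refine ⟨?_, fun hx x hxs => hP.mem_of_pow_mem (p ^ e) (hx (List.mem_map_of_mem hxs))⟩
  rintro hx _ hy
  obtain ⟨x, hxs, rfl⟩ := List.mem_map.1 hy
  exact Ideal.pow_mem_of_mem _ (hx hxs) _ (pow_pos (Fact.out : p.Prime).pos _)

theorem height_ofList_of_map_eq_map_pow {p : ℕ} [Fact p.Prime] [IsPRadical i p]
    (hi : Function.Injective i) {xs : List S} {rs : List R}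
    {e : ℕ} (h : rs.map i = xs.map (· ^ p ^ e)) :
    (Ideal.ofList rs).height = (Ideal.ofList xs).height :=
  height_eq_of_forall_le_iff i p hi fun _ hP => ofList_le_iff_of_map_eq_map_pow i h hP

/-- Frobenius is an automorphism of a perfect ring, so p^e-th roots may be taken in ideal
membership. -/
theorem mem_ofList_map_pow_iff {S : Type v} [CommRing S] (p : ℕ) [Fact p.Prime] [CharP S p]
    [PerfectRing S p] {xs : List S} {e : ℕ} {s : S} :
    s ^ p ^ e ∈ Ideal.ofList (xs.map (· ^ p ^ e)) ↔ s ∈ Ideal.ofList xs := by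
  have h : Ideal.ofList (xs.map (· ^ p ^ e)) =
      (Ideal.ofList xs).map (iterateFrobeniusEquiv S p e : S →+* S) := by
    rw [Ideal.map_ofList]
    rfl
  rw [h]
  refine ⟨fun hs => ?_, fun hs => Ideal.mem_map_of_mem (iterateFrobeniusEquiv S p e : S →+* S) hs⟩
  obtain ⟨t, ht, hts⟩ := (Ideal.mem_map_of_equiv (iterateFrobeniusEquiv S p e) _).1 hs
  rwa [← (iterateFrobeniusEquiv S p e).injective hts]

/-- In the perfect closure of a regular local ring, elements that generate a proper ideal of height
at least their number form a regular sequence. -/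
theorem isWeaklyRegular_of_isPRadical (p : ℕ) [Fact p.Prime] [CharP R p] [CharP S p]
    [IsPRadical i p] [IsRegularLocalRing R] [PerfectRing S p]
    (hi : Function.Injective i) {xs : List S} (hne : Ideal.ofList xs ≠ ⊤)
    (hht : (xs.length : ℕ∞) ≤ (Ideal.ofList xs).height) : IsWeaklyRegular S xs := by
  rw [isWeaklyRegular_self_iff]
  intro j hj s hs
  obtain ⟨e, ⟨rs, hrs⟩, t, ht⟩ := ((eventually_exists_map_eq_map_pow i p xs).and
    (eventually_exists_eq_pow i p s)).exists
  have hlen : rs.length = xs.length := by simpa using congrArg List.length hrs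
  have hj' : j < rs.length := hlen ▸ hj
  have hrsj : i rs[j] = xs[j] ^ p ^ e := by
    have := List.getElem_of_eq hrs (i := j) (by simpa using hj')
    simpa using this
  have htake (k : ℕ) : (rs.take k).map i = (xs.take k).map (· ^ p ^ e) := by
    rw [List.map_take, hrs, List.map_take]
  have hmem : i (rs[j] * t) ∈ (Ideal.ofList (rs.take j)).map i := by
    rw [Ideal.map_ofList, htake, map_mul, hrsj, ht, ← mul_pow, mem_ofList_map_pow_iff]
    exact hs
  -- The relation now has entries in `R` but holds only in the ideal extended to `S`. A further
  -- power p^f makes it hold in `R`.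
  obtain ⟨f, t', ht', hit'⟩ :=
    (eventually_exists_mem_map_iterateFrobenius i p _ hmem).exists
  obtain rfl : t' = (rs[j] * t) ^ p ^ f := hi (by rw [hit', map_pow])
  have hmap : (rs.map (iterateFrobenius R p f)).map i = xs.map (· ^ p ^ (e + f)) := by
    have : (rs.map i).map (· ^ p ^ f) = (rs.map (iterateFrobenius R p f)).map i := by
      simp [List.map_map, Function.comp_def, iterateFrobenius_def]
    rw [← this, hrs, List.map_map]
    exact List.map_congr_left fun x _ => by simp [← pow_mul, ← pow_add]
  -- The p^f-th powers of `rs` inherit properness and height from `xs`, since primes do not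
  -- distinguish an element from its powers.
  have hreg : IsWeaklyRegular R (rs.map (iterateFrobenius R p f)) := by
    refine IsRegularLocalRing.isWeaklyRegular_of_length_le_height (fun htop => hne ?_) ?_
    · by_contra hne'
      obtain ⟨P, hP, hle⟩ := Ideal.exists_le_maximal _ hne'
      have := (ofList_le_iff_of_map_eq_map_pow i hmap hP.isPrime).1 hle
      rw [htop, top_le_iff] at this
      exact hP.ne_top (Ideal.comap_eq_top_iff.1 this)
    · rwa [height_ofList_of_map_eq_map_pow i hi hmap, List.length_map, hlen]
  have hfin := isWeaklyRegular_self_iff.1 hreg j (by simpa using hj') (t ^ p ^ f) (by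
    rw [← List.map_take, ← Ideal.map_ofList]
    simpa [iterateFrobenius_def, mul_pow] using ht')
  rw [← mem_ofList_map_pow_iff p (e := e + f)]
  have := Ideal.mem_map_of_mem i hfin
  rw [Ideal.map_ofList, List.map_take, hmap, ← List.map_take, map_pow, ht, ← pow_mul,
    ← pow_add] at this
  exact this

end PerfectClosure

/-! ### Torsion in the top Čech cohomology. -/

section CechTop

variable {A : Type u} [CommRing A] {k : ℕ} {x : Fin (k + 1) → A}

theorem cechCochain_top_ext {f g : CechCochain x (k + 1)}
    (h : f ⟨Finset.univ, by simp⟩ = g ⟨Finset.univ, by simp⟩) : f = g := by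
  funext ⟨I, hI⟩
  obtain rfl : I = Finset.univ := Finset.card_eq_iff_eq_univ I |>.1 (by simpa using hI)
  exact h

theorem cechD_single_univ (j : Fin (k + 1)) (h : CechTerm x (Finset.univ.erase j)) :
    cechD x k (Pi.single (M := fun I : {I : Finset (Fin (k + 1)) // I.card = k} => CechTerm x I.1)
        ⟨Finset.univ.erase j, by simp⟩ h) ⟨Finset.univ, by simp⟩ =
      (-1 : ℤ) ^ ({i ∈ Finset.univ | i < j} : Finset (Fin (k + 1))).card •
        cechRestrict x (Finset.erase_subset j Finset.univ) h := by
  rw [cechD, LinearMap.pi_apply, LinearMap.sum_apply,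
    Finset.sum_eq_single ⟨j, Finset.mem_univ j⟩]
  · simp
  · rintro ⟨j', hj'⟩ - hne
    have hne' : (⟨Finset.univ.erase j', by simp⟩ : {I : Finset (Fin (k + 1)) // I.card = k}) ≠
        ⟨Finset.univ.erase j, by simp⟩ := by
      intro heq
      have := congrArg Subtype.val heq
      exact hne (Subtype.ext (Finset.erase_injOn Finset.univ (Finset.mem_univ _)
        (Finset.mem_univ _) this))
    simp [Pi.single_eq_of_ne hne']
  · intro h
    exact absurd (Finset.mem_univ _) h

theorem mem_range_cechD_of_eq_sum {f : CechCochain x (k + 1)}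
    (h : ∀ j : Fin (k + 1), CechTerm x (Finset.univ.erase j))
    (hf : f ⟨Finset.univ, by simp⟩ =
      ∑ j, cechRestrict x (Finset.erase_subset j Finset.univ) (h j)) :
    f ∈ LinearMap.range (cechD x k) := by
  refine ⟨∑ j, (-1 : ℤ) ^ ({i ∈ Finset.univ | i < j} : Finset (Fin (k + 1))).card •
    Pi.single (M := fun I : {I : Finset (Fin (k + 1)) // I.card = k} => CechTerm x I.1)
        ⟨Finset.univ.erase j, by simp⟩ (h j), cechCochain_top_ext ?_⟩
  rw [hf, map_sum, Finset.sum_apply]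
  refine Finset.sum_congr rfl fun j _ => ?_
  rw [map_zsmul, Pi.smul_apply, cechD_single_univ, smul_smul, ← mul_pow]
  simp

/-- If `x_k` lies in the radical of `(x_0, …, x_{k-1})` up to a multiplier `s`, then a power of `s`
annihilates any given element of the top Čech cohomology. -/
theorem exists_pow_smul_cechCohomology_eq_zero {s : A} {N : ℕ}
    (hs : s * x (Fin.last k) ^ N ∈ Ideal.span (Set.range fun j : Fin k => x j.castSucc))
    (c : CechCohomology x (k + 1)) : ∃ m : ℕ, s ^ m • c = 0 := by
  obtain ⟨⟨f, hf⟩, rfl⟩ := Submodule.mkQ_surjective _ c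
  let u : A := ∏ j, x j
  let T := CechTerm x Finset.univ
  -- The top cochain is `b / u^n`. Once `(s x_l^N)^m = ∑ a_j x_j^n` with `l` the last index, `s^m b
  -- / u^n` is the sum of the `a_j b / (w_j^n x_l^(Nm))`.
  obtain ⟨n, b, hb⟩ := IsLocalization.Away.surj u (f ⟨Finset.univ, by simp⟩ : T)
  have hrad : Ideal.span (Set.range fun j : Fin k => x j.castSucc) ≤
      (Ideal.span (Set.range fun j : Fin k => x j.castSucc ^ n)).radical := by
    rw [Ideal.span_le]
    rintro _ ⟨j, rfl⟩
    exact ⟨n, Ideal.subset_span ⟨j, rfl⟩⟩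
  obtain ⟨m, hm⟩ := hrad hs
  obtain ⟨a, ha⟩ := Ideal.mem_span_range_iff_exists_fun.1 hm
  refine ⟨m, ?_⟩
  rw [← map_smul, Submodule.mkQ_apply, Submodule.Quotient.mk_eq_zero]
  change s ^ m • f ∈ LinearMap.range (cechD x k)
  set l := Fin.last k
  let w (j : Fin (k + 1)) : A := ∏ i ∈ Finset.univ.erase j, x i
  have hw (j : Fin (k + 1)) : x j * w j = u := Finset.mul_prod_erase _ _ (Finset.mem_univ j)
  -- For `j` other than the last index, `x l` divides `w j`, so this denominator is already
  -- invertible in the term that omits `x j`.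
  have hunit (j : Fin k) : IsUnit (algebraMap A (CechTerm x (Finset.univ.erase j.castSucc))
      (w j.castSucc ^ n * x l ^ (N * m))) := by
    have hwu : IsUnit (algebraMap A (CechTerm x (Finset.univ.erase j.castSucc))
      (w j.castSucc)) := IsLocalization.Away.algebraMap_isUnit _
    rw [map_mul, map_pow, map_pow]
    refine (hwu.pow n).mul (IsUnit.pow _ (isUnit_of_dvd_unit (map_dvd _ ?_) hwu))
    exact Finset.dvd_prod_of_mem x
      (Finset.mem_erase.2 ⟨(Fin.castSucc_lt_last j).ne', Finset.mem_univ _⟩)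
  choose v hv using fun j => (hunit j).exists_right_inv
  let h : ∀ j : Fin (k + 1), CechTerm x (Finset.univ.erase j) :=
    Fin.lastCases 0 fun j => algebraMap A _ (a j * b) * v j
  refine mem_range_cechD_of_eq_sum h ?_
  have huT : IsUnit (algebraMap A T (u ^ n * x l ^ (N * m))) := by
    have hu : IsUnit (algebraMap A T u) := IsLocalization.Away.algebraMap_isUnit _
    rw [map_mul, map_pow, map_pow]
    refine (hu.pow n).mul (IsUnit.pow _ (isUnit_of_dvd_unit (map_dvd _ ?_) hu))
    exact Finset.dvd_prod_of_mem x (Finset.mem_univ _)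
  refine huT.mul_left_injective ?_
  have hterm (j : Fin k) : cechRestrict x (Finset.erase_subset j.castSucc Finset.univ)
      (h j.castSucc) * algebraMap A T (u ^ n * x l ^ (N * m)) =
        algebraMap A T (b * (a j * x j.castSucc ^ n)) := by
    have h1 : algebraMap A T (u ^ n * x l ^ (N * m)) = algebraMap A T (x j.castSucc ^ n) *
        cechRestrict x (Finset.erase_subset j.castSucc Finset.univ)
          (algebraMap A _ (w j.castSucc ^ n * x l ^ (N * m))) := by
      rw [AlgHom.commutes, ← map_mul, ← hw j.castSucc, mul_pow, mul_assoc]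
    have h2 : h j.castSucc = algebraMap A _ (a j * b) * v j := by simp [h]
    rw [h1, h2, mul_left_comm, ← map_mul, mul_assoc, mul_comm (v j), hv, mul_one, AlgHom.commutes,
      ← map_mul]
    congr 1
    ring
  have hlast : h l = 0 := by simp [h, l]
  simp only
  rw [Finset.sum_mul, Fin.sum_univ_castSucc, Finset.sum_congr rfl fun j _ => hterm j, hlast,
    map_zero, zero_mul, add_zero, ← map_sum, ← Finset.mul_sum, ha, Pi.smul_apply, Algebra.smul_def,
    map_mul (algebraMap A T) (u ^ n), map_pow, map_pow]
  rw [mul_pow, ← pow_mul, map_mul (algebraMap A T) b, ← hb]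
  simp only [map_mul, map_pow]
  ring

theorem subsingleton_localizedModule_cechCohomology {P : Ideal A} [P.IsPrime] {s : A} {N : ℕ}
    (hsP : s ∉ P)
    (hs : s * x (Fin.last k) ^ N ∈ Ideal.span (Set.range fun j : Fin k => x j.castSucc)) :
    Subsingleton (LocalizedModule P.primeCompl (CechCohomology x (k + 1))) := by
  rw [LocalizedModule.subsingleton_iff]
  intro c
  obtain ⟨m, hm⟩ := exists_pow_smul_cechCohomology_eq_zero hs c
  exact ⟨s ^ m, pow_mem (S := P.primeCompl) hsP m, hm⟩

end CechTop

/-! ### The Cohen-Macaulay properties of the perfect closure. -/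

section CohenMacaulayPerfect

theorem exists_ofList_eq_of_fg {A : Type u} [CommRing A] {I : Ideal A} (hI : I.FG) :
    ∃ xs : List A, Ideal.ofList xs = I ∧ xs.length = I.spanFinrank := by
  have hfin := Submodule.FG.finite_generators hI
  refine ⟨hfin.toFinset.toList, ?_, ?_⟩
  · simp only [Ideal.ofList, Finset.mem_toList, Set.Finite.mem_toFinset]
    exact I.span_generators
  · rw [Finset.length_toList, ← Set.ncard_eq_toFinset_card _ hfin, Submodule.FG.generators_ncard hI]

variable {R : Type u} {S : Type v} [CommRing R] [CommRing S] (i : R →+* S)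

theorem height_ne_top_of_isPRadical (p : ℕ) [Fact p.Prime] [IsPRadical i p] [IsNoetherianRing R]
    (hi : Function.Injective i) {a : Ideal S} (ha : a ≠ ⊤) : a.height ≠ ⊤ := by
  rw [← height_comap i p hi]
  exact Ideal.height_ne_top (mt Ideal.comap_eq_top_iff.1 ha)

/-- Every proper ideal contains a regular sequence of length equal to its height. -/
theorem exists_isWeaklyRegular_length_eq_height (p : ℕ) [Fact p.Prime] [CharP R p] [CharP S p]
    [IsPRadical i p] [IsRegularLocalRing R] [PerfectRing S p] (hi : Function.Injective i)
    {a : Ideal S} (ha : a ≠ ⊤) :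
    ∃ xs : List S, Ideal.ofList xs ≤ a ∧ IsWeaklyRegular S xs ∧ (xs.length : ℕ∞) = a.height ∧
      (Ideal.ofList xs).height = a.height := by
  -- The converse of Krull's height theorem in the Noetherian ring `R` gives a subideal of the
  -- contraction with the same height, generated by that many elements.
  obtain ⟨J, hJ, hrank, hht⟩ := Ideal.exists_spanRank_eq_and_height_eq (a.comap i)
    (mt Ideal.comap_eq_top_iff.1 ha)
  have hfg : J.FG := IsNoetherian.noetherian J
  obtain ⟨rs, hrs, hlen⟩ := exists_ofList_eq_of_fg hfg
  have hle : Ideal.ofList (rs.map i) ≤ a := by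
    rw [← Ideal.map_ofList, hrs]
    exact Ideal.map_le_iff_le_comap.2 hJ
  have hht' : (Ideal.ofList (rs.map i)).height = a.height := by
    rw [← height_ofList_of_map_eq_map_pow i hi (p := p) (e := 0) (rs := rs) (by simp), hrs, hht,
      height_comap i p hi]
  have hlen' : ((rs.map i).length : ℕ∞) = a.height := by
    rw [Submodule.fg_iff_spanRank_eq_spanFinrank.2 hfg, height_comap i p hi] at hrank
    rw [List.length_map, hlen]
    exact_mod_cast hrank
  refine ⟨_, hle, isWeaklyRegular_of_isPRadical i p hi
    (fun h => ha (top_le_iff.1 (h ▸ hle))) ?_, hlen', hht'⟩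
  rw [hlen', hht']

theorem height_eq_koszulGrade (p : ℕ) [Fact p.Prime] [CharP R p] [CharP S p]
    [IsPRadical i p] [IsRegularLocalRing R] [PerfectRing S p] (hi : Function.Injective i)
    (a : Ideal S) : a.height = koszulGrade a S := by
  by_cases ha : a = ⊤
  · rw [ha, Ideal.height_top, koszulGrade_top]
  refine le_antisymm ?_ ?_
  · obtain ⟨xs, hle, hreg, hlen, -⟩ := exists_isWeaklyRegular_length_eq_height i p hi ha
    rw [← hlen]
    exact length_le_koszulGrade (fun y hy => hle (Ideal.subset_span hy)) hreg
  · obtain ⟨n, hn⟩ := ENat.ne_top_iff_exists.1 (height_ne_top_of_isPRadical i p hi ha)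
    -- For the upper bound, a prime over `a` of the same height is minimal over a regular sequence
    -- of that length.
    obtain ⟨P, hP, haP, hPn⟩ := Ideal.exists_isPrime_height_eq hn.symm
    obtain ⟨xs, hle, hreg, hlen, hht⟩ :=
      exists_isWeaklyRegular_length_eq_height i p hi hP.ne_top
    have : P.FiniteHeight := ⟨Or.inr (height_ne_top_of_isPRadical i p hi hP.ne_top)⟩
    rw [← hn, ← hPn, ← hlen]
    exact koszulGrade_le_of_mem_minimalPrimes hreg
      (Ideal.mem_minimalPrimes_of_height_le hle hht.ge) haP

theorem isGlazCM_of_isPRadical (p : ℕ) [Fact p.Prime] [CharP R p] [CharP S p]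
    [IsPRadical i p] [IsRegularLocalRing R] [PerfectRing S p] (hi : Function.Injective i) :
    IsGlazCM S := by
  intro P hP
  obtain ⟨xs, hle, hreg, hlen, hht⟩ := exists_isWeaklyRegular_length_eq_height i p hi hP.ne_top
  let L := Localization.AtPrime P
  have hreg' : IsWeaklyRegular L (xs.map (algebraMap S L)) := hreg.of_isLocalization L P.primeCompl
  have hdisj : Disjoint (P.primeCompl : Set S) (P : Set S) :=
    Set.disjoint_left.2 fun a ha ha' => ha ha'
  have hPL : (P.map (algebraMap S L)).height = P.height :=
    IsLocalization.height_map_of_disjoint P.primeCompl P hdisj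
  have hPL' : (P.map (algebraMap S L)).IsPrime :=
    IsLocalization.isPrime_of_isPrime_disjoint P.primeCompl L P hP hdisj
  have : (P.map (algebraMap S L)).FiniteHeight :=
    ⟨Or.inr (hPL ▸ height_ne_top_of_isPRadical i p hi hP.ne_top)⟩
  have hle' : Ideal.ofList (xs.map (algebraMap S L)) ≤ P.map (algebraMap S L) := by
    rw [← Ideal.map_ofList]
    exact Ideal.map_mono hle
  have hmin : P.map (algebraMap S L) ∈ (Ideal.ofList (xs.map (algebraMap S L))).minimalPrimes := by
    refine Ideal.mem_minimalPrimes_of_height_le hle' ?_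
    -- The extended sequence still has height at least that of `P`, so the extended prime stays
    -- minimal over it.
    rw [hPL, ← hht, ← Ideal.map_ofList, ← IsLocalization.height_under P.primeCompl
      ((Ideal.ofList xs).map (algebraMap S L))]
    exact Ideal.height_mono Ideal.le_comap_map
  rw [← hlen, ← List.length_map (as := xs) (algebraMap S L)]
  exact le_antisymm (length_le_koszulGrade (fun y hy => hle' (Ideal.subset_span hy)) hreg')
    (koszulGrade_le_of_mem_minimalPrimes hreg' hmin le_rfl)

theorem mem_minimalPrimes_of_comap_mem (p : ℕ) [Fact p.Prime] [IsPRadical i p]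
    {a q : Ideal S} [hq : q.IsPrime] (haq : a ≤ q)
    (h : q.comap i ∈ (a.comap i).minimalPrimes) : q ∈ a.minimalPrimes := by
  refine ⟨⟨hq, haq⟩, fun P hP hPq => ?_⟩
  have := hP.1
  exact (le_iff_comap_le_comap i p q hP.1).2
    (h.2 ⟨inferInstance, Ideal.comap_mono hP.2⟩ (Ideal.comap_mono hPq))

/-- A prime that properly contains a minimal prime of `a` holds an element raising the height. -/
theorem exists_mem_height_add_one_le (p : ℕ) [Fact p.Prime] [IsPRadical i p] [IsNoetherianRing R]
    (hi : Function.Injective i)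
    {a q : Ideal S} [hq : q.IsPrime] (haq : a ≤ q)
    (hmin : q ∉ a.minimalPrimes) :
    ∃ z ∈ q, a.height + 1 ≤ (a ⊔ Ideal.span {z}).height := by
  -- Prime avoidance takes place in `R`, where Noetherianity makes the minimal primes finite in
  -- number.
  have hfin := (a.comap i).finite_minimalPrimes_of_isNoetherianRing
  obtain ⟨z, hz, hzP⟩ : ∃ z ∈ q.comap i, ∀ P ∈ (a.comap i).minimalPrimes, z ∉ P := by
    by_contra! hcon
    obtain ⟨P, hP, hle⟩ := (Ideal.subset_union_prime (s := hfin.toFinset) (f := id) ⊤ ⊤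
      (fun Q hQ _ _ => ((Set.Finite.mem_toFinset _).1 hQ).1.1) (I := q.comap i)).1 fun z hz => by
        obtain ⟨P, hP, hzP⟩ := hcon z hz
        simp only [Set.mem_iUnion]
        exact ⟨P, by simpa using hP, hzP⟩
    rw [Set.Finite.mem_toFinset] at hP
    have heq : q.comap i = P :=
      le_antisymm hle (hP.2 ⟨inferInstance, Ideal.comap_mono haq⟩ hle)
    exact hmin (mem_minimalPrimes_of_comap_mem i p haq (heq ▸ hP))
  refine ⟨i z, hz, le_height_iff.2 fun P hP hle => ?_⟩
  rw [← height_comap i p hi, ← height_comap i p hi]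
  have haP : a.comap i ≤ P.comap i := Ideal.comap_mono (le_sup_left.trans hle)
  obtain ⟨Q, hQ, hQP⟩ := Ideal.exists_minimalPrimes_le haP
  have hQprime := hQ.1.1
  have hlt : Q < P.comap i := lt_of_le_of_ne hQP fun h => hzP Q hQ (by
    rw [h]
    exact hle (Ideal.mem_sup_right (Ideal.mem_span_singleton_self _)))
  exact (add_le_add_left (Ideal.height_mono hQ.1.2) 1).trans
    (Ideal.height_add_one_le_of_lt_of_isPrime hlt)

theorem isWeakBourbakiUnmixed_of_isPRadical (p : ℕ) [Fact p.Prime] [CharP R p] [CharP S p]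
    [IsPRadical i p] [IsRegularLocalRing R] [PerfectRing S p] (hi : Function.Injective i) :
    IsWeakBourbakiUnmixed S := by
  intro a hfg hht
  refine Set.Subset.antisymm (fun P hP => ?_) ?_
  · refine ⟨Ideal.Quotient.mk a 1, ?_⟩
    convert hP
    ext s
    rw [LinearMap.mem_ker, LinearMap.toSpanSingleton_apply, ← Ideal.Quotient.eq_zero_iff_mem]
    simp [Algebra.smul_def]
  · rintro q ⟨m, hq⟩
    obtain ⟨s, rfl⟩ := Ideal.Quotient.mk_surjective m
    have hker (t : S) :
        t ∈ LinearMap.ker (LinearMap.toSpanSingleton S (S ⧸ a) (Ideal.Quotient.mk a s)) ↔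
          t * s ∈ a := by
      rw [LinearMap.mem_ker, LinearMap.toSpanSingleton_apply, ← Ideal.Quotient.eq_zero_iff_mem,
        map_mul]
      rfl
    have hqprime := hq.1.1
    have haq : a ≤ q := fun t ht => hq.1.2 ((hker t).2 (Ideal.mul_mem_right _ _ ht))
    by_contra hmin
    obtain ⟨z, hzq, hz⟩ := exists_mem_height_add_one_le i p hi haq hmin
    obtain ⟨xs, rfl, hlen⟩ := exists_ofList_eq_of_fg hfg
    -- Appending `z` raises both length and height by one, so `z` is a nonzerodivisor modulo `a`.
    -- This contradicts minimality of `q` over `(a : s)`, which yields `t ∉ q` with `t z^n s ∈ a`.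
    have hreg : IsWeaklyRegular S (xs ++ [z]) := by
      refine isWeaklyRegular_of_isPRadical i p hi (fun htop => hqprime.ne_top ?_) ?_
      · rw [Ideal.ofList_append, Ideal.ofList_singleton] at htop
        exact top_le_iff.1 (htop ▸ sup_le haq ((Ideal.span_singleton_le_iff_mem _).2 hzq))
      · rw [Ideal.ofList_append, Ideal.ofList_singleton, List.length_append, hlen]
        refine le_trans ?_ hz
        push_cast
        exact add_le_add_left hht 1
    have hnzd (t : S) (ht : z * t ∈ Ideal.ofList xs) : t ∈ Ideal.ofList xs := by
      have := isWeaklyRegular_self_iff.1 hreg xs.length (by simp) t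
      simp only [List.take_left', List.getElem_concat_length] at this
      exact this ht
    have hnzd' (n : ℕ) (t : S) (ht : z ^ n * t ∈ Ideal.ofList xs) : t ∈ Ideal.ofList xs := by
      induction n with
      | zero => simpa using ht
      | succ n ih => exact ih (hnzd _ (by rwa [pow_succ', mul_assoc] at ht))
    obtain ⟨t, n, htq, htn⟩ := exists_mul_pow_mem_of_mem_minimalPrimes hq hzq
    refine htq (hq.1.2 ((hker t).2 (hnzd' n _ ?_)))
    have := (hker _).1 htn
    rwa [mul_right_comm, mul_comm] at this

/-- By induction the first `k` elements have height at least `k`. A prime of height at most `k`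
containing the next one is then minimal over them, so the top Čech cohomology vanishes there. -/
theorem le_height_of_isStrongParameterSequence (p : ℕ) [Fact p.Prime] [IsPRadical i p]
    [IsNoetherianRing R] (hi : Function.Injective i) {l : ℕ} {x : Fin l → S}
    (hx : IsStrongParameterSequence x) (k : ℕ) (hk : k ≤ l) :
    (k : ℕ∞) ≤ (Ideal.span (Set.range fun j : Fin k => x (Fin.castLE hk j))).height := by
  induction k with
  | zero => simp
  | succ k ih =>
    have ih := ih (Nat.le_of_succ_le hk)
    refine le_height_iff.2 fun P hP hle => ?_
    by_contra! hlt
    have hlt' : P.height ≤ k := ENat.lt_natCast_add_one_iff.1 (by simpa using hlt)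
    have hle' : Ideal.span (Set.range fun j : Fin k => x (Fin.castLE (Nat.le_of_succ_le hk) j)) ≤
        P := by
      refine (Ideal.span_mono ?_).trans hle
      rintro _ ⟨j, rfl⟩
      exact ⟨j.castSucc, rfl⟩
    have : P.FiniteHeight := ⟨Or.inr (height_ne_top_of_isPRadical i p hi hP.ne_top)⟩
    have hmin := Ideal.mem_minimalPrimes_of_height_le hle' (hlt'.trans ih)
    obtain ⟨s, N, hs, hsN⟩ := exists_mul_pow_mem_of_mem_minimalPrimes hmin
      (hle (Ideal.subset_span ⟨Fin.last k, rfl⟩))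
    have hsub := subsingleton_localizedModule_cechCohomology
      (x := fun j : Fin (k + 1) => x (Fin.castLE hk j)) hs hsN
    have hnt := (hx (k + 1) hk (by omega)).cech_ne_zero P hle
    exact not_subsingleton _ hsub

theorem isHamiltonMarleyCM_of_isPRadical (p : ℕ) [Fact p.Prime] [CharP R p] [CharP S p]
    [IsPRadical i p] [IsRegularLocalRing R] [PerfectRing S p] (hi : Function.Injective i) :
    IsHamiltonMarleyCM S := by
  intro l x hx
  have hspan : Ideal.ofList (List.ofFn x) = Ideal.span (Set.range x) := by
    simp only [Ideal.ofList, List.mem_ofFn']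
    rfl
  have hne : Ideal.ofList (List.ofFn x) ≠ ⊤ := by
    rw [hspan]
    -- For the empty sequence the parameter condition is vacuous, and properness comes from `S`
    -- being nontrivial.
    rcases Nat.eq_zero_or_pos l with rfl | hl
    · have : Nontrivial S := hi.nontrivial
      simp
    · exact (hx l le_rfl hl).span_ne_top
  refine ⟨isWeaklyRegular_of_isPRadical i p hi hne ?_, ?_⟩
  · rw [hspan, List.length_ofFn]
    exact le_height_of_isStrongParameterSequence i p hi hx l le_rfl
  · rw [smul_eq_mul, Ideal.mul_top]
    exact hne.symm

end CohenMacaulayPerfect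

end NonNoetherianCM

end

theorem theorem4p5 (p : ℕ) [Fact p.Prime] (R : Type*) [CommRing R] [CharP R p]
    [IsRegularLocalRing R] :
    NonNoetherianCM.IsHamiltonMarleyCM (PerfectClosure R p) ∧
    NonNoetherianCM.IsGlazCM (PerfectClosure R p) ∧
    NonNoetherianCM.IsWeakBourbakiUnmixed (PerfectClosure R p) ∧
    (∀ 𝒜 : Set (Ideal (PerfectClosure R p)), 𝒜.Nonempty → NonNoetherianCM.IsCMInSenseOf 𝒜) ∧
    NonNoetherianCM.IsCMInSenseOf {q : Ideal (PerfectClosure R p) | q.IsPrime} ∧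
    NonNoetherianCM.IsCMInSenseOf {q : Ideal (PerfectClosure R p) | q.IsMaximal} ∧
    NonNoetherianCM.IsCMInSenseOf (Set.univ : Set (Ideal (PerfectClosure R p))) ∧
    NonNoetherianCM.IsCMInSenseOf {a : Ideal (PerfectClosure R p) | a.FG} := by
  -- A domain is reduced, which makes the map to the perfect closure injective.
  have : IsDomain R := NonNoetherianCM.isDomain_of_isRegularLocalRing R
  have : IsPRadical (PerfectClosure.of R p) p := inferInstance
  have hi : Function.Injective (PerfectClosure.of R p) := fun x y h => by
    simpa [PerfectClosure.of_apply, PerfectClosure.eq_iff] using h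
  have hgrade (𝒜 : Set (Ideal (PerfectClosure R p))) : NonNoetherianCM.IsCMInSenseOf 𝒜 :=
    fun a _ => NonNoetherianCM.height_eq_koszulGrade (PerfectClosure.of R p) p hi a
  exact ⟨NonNoetherianCM.isHamiltonMarleyCM_of_isPRadical (PerfectClosure.of R p) p hi,
    NonNoetherianCM.isGlazCM_of_isPRadical (PerfectClosure.of R p) p hi,
    NonNoetherianCM.isWeakBourbakiUnmixed_of_isPRadical (PerfectClosure.of R p) p hi,
    fun 𝒜 _ => hgrade 𝒜, hgrade _, hgrade _, hgrade _, hgrade _⟩
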